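/- Let $G$ be a topological group and $(\mathcal L,\eta)$ a host algebra for $G$: $\mathcal L$ is a $C^*$-algebra and $\eta:G\to U(M(\mathcal L))$ is a homomorphism such that $\tilde\pi\circ\eta$ is strongly continuous for every nondegenerate representation $\pi$ of $\mathcal L$ (with extension $\tilde\pi$ to the multiplier algebra $M(\mathcal L)$), and such that $\pi\mapsto\tilde\pi\circ\eta$ is injective on the nondegenerate representations of $\mathcal L$ on each Hilbert space. Let $\mathcal A$ be a $C^*$-algebra, $\alpha:G\to\mathrm{Aut}(\mathcal A)$ a homomorphism (no continuity assumed), and let $(\mathcal C,\eta_{\mathcal A},\eta_{\mathcal L})$ be a triple consisting of a $C^*$-algebra $\mathcal C$ and $*$-homomorphisms (CP1) $\eta_{\mathcal A}:\mathcal A\to M(\mathcal C)$ and $\eta_{\mathcal L}:\mathcal L\to M(\mathcal C)$, such that (CP4) $\eta_{\mathcal A}(\mathcal A)\eta_{\mathcal L}(\mathcal L)\subseteq\mathcal C$, and $\mathcal C$ is generated by this set as a $C^*$-algebra. Here and below a product of sets denotes the set of all products of their elements. Put $M(\mathcal C)_{\mathcal L}:=\eta_{\mathcal L}(\mathcal L)M(\mathcal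 C)\eta_{\mathcal L}(\mathcal L)$, $\mathcal C_{\mathcal L}:=M(\mathcal C)_{\mathcal L}\cap\mathcal C$ and $$\mathcal A_{\mathcal L}:=\{A\in\mathcal A\mid \eta_{\mathcal A}(A)\mathcal C_{\mathcal L}\subseteq\mathcal C_{\mathcal L}\ \text{and}\ \eta_{\mathcal A}(A^*)\mathcal C_{\mathcal L}\subseteq\mathcal C_{\mathcal L}\}.$$ Let $\mathcal C^{**}\supseteq M(\mathcal C)$ be the enveloping von Neumann algebra of $\mathcal C$. Then there is a unique $P\in\mathcal C^{**}$ with $P=\lim_j\eta_{\mathcal L}(E_j)$ weakly in $\mathcal C^{**}$ for every approximate identity $(E_j)$ of $\mathcal L$; it is a projection, and: (i) $\mathcal A_{\mathcal L}=\{A\in\mathcal A\mid[\eta_{\mathcal A}(A),P]=0\}=\{A\in\mathcal A\mid\eta_{\mathcal A}(A)=P\eta_{\mathcal A}(A)P+(\mathbf 1-P)\eta_{\mathcal A}(A)(\mathbf 1-P)\}$. (ii) $\mathcal A_{\mathcal L}=\{A\in\mathcal A\mid\eta_{\mathcal A}(A)\eta_{\mathcal L}(\mathcal L)\subseteq\eta_{\mathcal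 L}(\mathcal L)\mathcal C\ \text{and}\ \eta_{\mathcal A}(A^*)\eta_{\mathcal L}(\mathcal L)\subseteq\eta_{\mathcal L}(\mathcal L)\mathcal C\}$. (iii) For every approximate identity $(E_j)$ of $\mathcal L$, $$\mathcal A_{\mathcal L}=\{A\in\mathcal A\mid\|(\eta_{\mathcal L}(E_j)-\mathbf 1)\eta_{\mathcal A}(B)\eta_{\mathcal L}(L)\|\to0\ \text{for}\ B=A\ \text{and}\ B=A^*,\ \text{and all}\ L\in\mathcal L\}.$$ (iv) Call a nondegenerate representation $\rho$ of $\mathcal C$ an $\mathcal L$-representation if $\tilde\rho\circ\eta_{\mathcal L}$ is nondegenerate; let $U^\rho$ be the unitary representation of $G$ determined by $U^\rho(g)(\tilde\rho\circ\eta_{\mathcal L})(L)=(\tilde\rho\circ\eta_{\mathcal L})(\eta(g)L)$, and let $\rho_u$ be the direct sum of the GNS representations of all states of $\mathcal C$ whose GNS representation is an $\mathcal L$-representation. Assume in addition (CP3') $\rho_u$ is faithful, and $U^{\rho_u}(g)\,\tilde\rho_u(\eta_{\mathcal A}(A))\,U^{\rho_u}(g)^*=\tilde\rho_u(\eta_{\mathcal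 A}(\alpha_g(A)))$ for all $g\in G$, $A\in\mathcal A$. Then $\mathcal A_{\mathcal L}$ is a closed $*$-subalgebra of $\mathcal A$ with $\alpha_g(\mathcal A_{\mathcal L})=\mathcal A_{\mathcal L}$ for all $g\in G$, and it contains every $A\in\mathcal A$ with $\alpha_g(A)=A$ for all $g\in G$. -/

import Mathlib

open scoped MultiplierAlgebra InnerProductSpace ComplexOrder Pointwise lp
open Filter Topology

universe u v w

namespace CrossedHost

noncomputable section

/-! ### Nondegenerate representations and their multiplier extensions -/

section Representations

variable {A : Type*} [NonUnitalCStarAlgebra A]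
variable {H : Type*} [NormedAddCommGroup H] [InnerProductSpace ℂ H] [CompleteSpace H]

/-- A homomorphism `π : A → B(H)` is nondegenerate if the span of `π(A)H` is dense in `H`. -/
def IsNondegenerate (π : A →⋆ₙₐ[ℂ] (H →L[ℂ] H)) : Prop :=
  Dense (Submodule.span ℂ {x : H | ∃ a v, π a v = x} : Set H)

theorem isNondegenerate_iff (π : A →⋆ₙₐ[ℂ] (H →L[ℂ] H)) :
    IsNondegenerate π ↔ ∀ v, (∀ a, π a v = 0) → v = 0 := by
  rw [IsNondegenerate, Submodule.dense_iff_topologicalClosure_eq_top,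
    Submodule.topologicalClosure_eq_top_iff, Submodule.eq_bot_iff]
  have key (v : H) : v ∈ (Submodule.span ℂ {x : H | ∃ a v, π a v = x})ᗮ ↔
      ∀ a, π a v = 0 := by
    rw [Submodule.mem_orthogonal]
    constructor
    · intro h a
      have := h (π (star a) (π a v)) (Submodule.subset_span ⟨_, _, rfl⟩)
      rw [map_star, ContinuousLinearMap.star_eq_adjoint,
        ContinuousLinearMap.adjoint_inner_left] at this
      exact inner_self_eq_zero.1 this
    · intro h x hx
      induction hx using Submodule.span_induction with
      | mem x hx =>
        obtain ⟨a, y, rfl⟩ := hx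
        have h1 : π a = ContinuousLinearMap.adjoint (π (star a)) := by
          rw [← ContinuousLinearMap.star_eq_adjoint, ← map_star, star_star]
        rw [h1, ContinuousLinearMap.adjoint_inner_left, h, inner_zero_right]
      | zero => simp
      | add x y _ _ hx hy => rw [inner_add_left, hx, hy, add_zero]
      | smul c x _ hx => rw [inner_smul_left, hx, mul_zero]
  simp only [key]

variable (A H) in
/-- `Rep(A, H)`: the nondegenerate representations of `A` on the Hilbert space `H`. -/
structure Rep where
  toHom : A →⋆ₙₐ[ℂ] (H →L[ℂ] H)
  nondegenerate : IsNondegenerate toHom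

namespace Rep

theorem clm_ext (π : Rep A H) {S T : H →L[ℂ] H}
    (h : ∀ a v, S (π.toHom a v) = T (π.toHom a v)) : S = T := by
  refine ContinuousLinearMap.ext_on π.nondegenerate ?_
  rintro _ ⟨a, v, rfl⟩
  exact h a v

theorem exists_ext_apply (π : Rep A H) (m : 𝓜(ℂ, A)) :
    ∃ T : H →L[ℂ] H, ∀ a v, T (π.toHom a v) = π.toHom (m.fst a) v := by
  let _ := CStarAlgebra.spectralOrder A
  have _ := CStarAlgebra.spectralOrderedRing A
  set l := CStarAlgebra.approximateUnit A
  have hl := CStarAlgebra.increasingApproximateUnit A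
  have : l.NeBot := hl.neBot
  have hmul (x a : A) : m.fst x * a = m.fst (x * a) := by
    have h (y : A) : y * (m.fst x * a) = y * m.fst (x * a) := by
      rw [← mul_assoc, ← m.central, mul_assoc, m.central]
    have h2 : star (m.fst x * a - m.fst (x * a)) * (m.fst x * a - m.fst (x * a)) = 0 := by
      rw [mul_sub, h, sub_self]
    exact sub_eq_zero.1 (CStarRing.star_mul_self_eq_zero_iff _ |>.1 h2)
  have hcont : Continuous π.toHom :=
    AddMonoidHomClass.continuous_of_bound π.toHom 1
      (by simpa only [one_mul] using! NonUnitalStarAlgHom.norm_apply_le π.toHom)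
  have hbound : ∀ᶠ x in l, ∀ v, ‖π.toHom (m.fst x) v‖ ≤ ‖m.fst‖ * ‖v‖ := by
    filter_upwards [hl.eventually_norm] with x hx v
    refine (ContinuousLinearMap.le_opNorm _ _).trans ?_
    gcongr
    refine (NonUnitalStarAlgHom.norm_apply_le π.toHom _).trans ?_
    exact m.fst.le_of_opNorm_le_of_le le_rfl hx |>.trans (by simp)
  have hK : ∀ v ∈ Submodule.span ℂ {x : H | ∃ a v, π.toHom a v = x},
      ∃ y, Tendsto (fun x => π.toHom (m.fst x) v) l (𝓝 y) := by
    intro v hv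
    induction hv using Submodule.span_induction with
    | mem x hx =>
      obtain ⟨a, w, rfl⟩ := hx
      refine ⟨π.toHom (m.fst a) w, ?_⟩
      have h1 : Tendsto (fun x => π.toHom (m.fst (x * a)) w) l (𝓝 (π.toHom (m.fst a) w)) :=
        ((ContinuousLinearMap.apply ℂ H w).continuous.comp
          (hcont.comp m.fst.continuous)).tendsto a |>.comp (hl.tendsto_mul_right a)
      refine h1.congr fun x => ?_
      rw [← hmul, map_mul]; rfl
    | zero => exact ⟨0, by simp⟩
    | add x y _ _ hx hy =>
      obtain ⟨x', hx⟩ := hx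
      obtain ⟨y', hy⟩ := hy
      exact ⟨x' + y', by simpa using hx.add hy⟩
    | smul c x _ hx =>
      obtain ⟨x', hx⟩ := hx
      exact ⟨c • x', by simpa using hx.const_smul c⟩
  have hall : ∀ v, ∃ y, Tendsto (fun x => π.toHom (m.fst x) v) l (𝓝 y) := by
    intro v
    rw [← cauchy_map_iff_exists_tendsto, Metric.cauchy_iff]
    refine ⟨inferInstance, fun ε hε => ?_⟩
    have hpos : 0 < ‖m.fst‖ + 1 := by positivity
    obtain ⟨k, hk, hvk⟩ := Metric.mem_closure_iff.1 (π.nondegenerate v)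
      (ε / 4 / (‖m.fst‖ + 1)) (by positivity)
    obtain ⟨y, hy⟩ := hK k hk
    have hy' : ∀ᶠ x in l, dist (π.toHom (m.fst x) k) y < ε / 4 :=
      (Metric.tendsto_nhds.1 hy) _ (by positivity)
    refine ⟨Metric.ball y (ε / 2), ?_, ?_⟩
    · rw [mem_map]
      filter_upwards [hy', hbound] with x h1 h2
      have h3 : dist (π.toHom (m.fst x) v) (π.toHom (m.fst x) k) ≤ ε / 4 := by
        rw [dist_eq_norm, ← map_sub]
        refine (h2 _).trans ?_
        rw [dist_eq_norm] at hvk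
        calc ‖m.fst‖ * ‖v - k‖ ≤ (‖m.fst‖ + 1) * (ε / 4 / (‖m.fst‖ + 1)) := by
              gcongr; linarith
          _ = ε / 4 := by field_simp
      simp only [Set.mem_preimage, Metric.mem_ball]
      linarith [dist_triangle (π.toHom (m.fst x) v) (π.toHom (m.fst x) k) y]
    · intro a ha b hb
      rw [Metric.mem_ball] at ha hb
      linarith [dist_triangle_right a b y]
  choose T hT using hall
  have hTp : Tendsto (fun x v => π.toHom (m.fst x) v) l (𝓝 T) := tendsto_pi_nhds.2 hT
  let T' : H →ₗ[ℂ] H := linearMapOfTendsto T (fun x => (π.toHom (m.fst x) : H →ₗ[ℂ] H)) hTp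
  refine ⟨T'.mkContinuous ‖m.fst‖ fun v => ?_, fun a v => ?_⟩
  · refine le_of_tendsto (hT v).norm ?_
    filter_upwards [hbound] with x hx using hx v
  · refine tendsto_nhds_unique (hT (π.toHom a v)) ?_
    have h1 : Tendsto (fun x => π.toHom (m.fst (x * a)) v) l (𝓝 (π.toHom (m.fst a) v)) :=
      ((ContinuousLinearMap.apply ℂ H v).continuous.comp
        (hcont.comp m.fst.continuous)).tendsto a |>.comp (hl.tendsto_mul_right a)
    refine h1.congr fun x => ?_
    rw [← hmul, map_mul]; rfl

/-- The multiplier extension `π̃ : M(A) → B(H)` of a nondegenerate representation `π` of `A`: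
the unique unital `*`-homomorphism extending `π`, determined by `π̃(m) π(a) v = π(m a) v`. -/
def multExt (π : Rep A H) : 𝓜(ℂ, A) →⋆ₐ[ℂ] (H →L[ℂ] H) where
  toFun m := (π.exists_ext_apply m).choose
  map_one' := π.clm_ext fun a v => by
    rw [(π.exists_ext_apply 1).choose_spec]; simp
  map_mul' m n := π.clm_ext fun a v => by
    simp only [mul_apply_eq_comp, (π.exists_ext_apply _).choose_spec]
    simp
  map_zero' := π.clm_ext fun a v => by
    rw [(π.exists_ext_apply 0).choose_spec]; simp
  map_add' m n := π.clm_ext fun a v => by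
    simp only [add_apply, (π.exists_ext_apply _).choose_spec]
    simp
  commutes' c := π.clm_ext fun a v => by
    rw [(π.exists_ext_apply _).choose_spec]
    simp [Algebra.algebraMap_eq_smul_one]
  map_star' m := by
    rw [ContinuousLinearMap.star_eq_adjoint, ContinuousLinearMap.eq_adjoint_iff]
    have h1 (a : A) (v y : H) :
        ⟪(π.exists_ext_apply (star m)).choose (π.toHom a v), y⟫_ℂ =
          ⟪π.toHom a v, (π.exists_ext_apply m).choose y⟫_ℂ := by
      have h2 : (innerSL ℂ ((π.exists_ext_apply (star m)).choose (π.toHom a v))) =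
          (innerSL ℂ (π.toHom a v)).comp (π.exists_ext_apply m).choose := by
        refine ContinuousLinearMap.ext_on π.nondegenerate ?_
        rintro _ ⟨b, w, rfl⟩
        simp only [ContinuousLinearMap.comp_apply, innerSL_apply_apply,
          (π.exists_ext_apply _).choose_spec]
        have h3 (c : A) (x z : H) :
            ⟪π.toHom c x, z⟫_ℂ = ⟪x, π.toHom (star c) z⟫_ℂ := by
          rw [map_star, ContinuousLinearMap.star_eq_adjoint,
            ContinuousLinearMap.adjoint_inner_right]
        rw [h3, h3, ← mul_apply_eq_comp, ← map_mul,
          ← mul_apply_eq_comp, ← map_mul]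
        simp only [DoubleCentralizer.star_fst, star_star, m.central]
      exact congrArg (fun f => f y) h2
    intro x y
    have h4 : Continuous fun x => ⟪(π.exists_ext_apply (star m)).choose x, y⟫_ℂ := by fun_prop
    have h5 : Continuous fun x : H => ⟪x, (π.exists_ext_apply m).choose y⟫_ℂ := by fun_prop
    have h6 : Set.EqOn (fun x => ⟪(π.exists_ext_apply (star m)).choose x, y⟫_ℂ)
        (fun x : H => ⟪x, (π.exists_ext_apply m).choose y⟫_ℂ)
        (Submodule.span ℂ {x : H | ∃ a v, π.toHom a v = x}) := by
      intro x hx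
      induction hx using Submodule.span_induction with
      | mem x hx => obtain ⟨a, v, rfl⟩ := hx; exact h1 a v y
      | zero => simp
      | add x z _ _ hx hz =>
        simp only at hx hz ⊢
        rw [map_add, inner_add_left, inner_add_left, hx, hz]
      | smul c x _ hx =>
        simp only at hx ⊢
        rw [map_smul, inner_smul_left, inner_smul_left, hx]
    exact congrFun (h4.ext_on π.nondegenerate h5 h6) x

theorem multExt_apply_apply (π : Rep A H) (m : 𝓜(ℂ, A)) (a : A) (v : H) :
    π.multExt m (π.toHom a v) = π.toHom (m.fst a) v :=
  (π.exists_ext_apply m).choose_spec a v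

theorem multExt_coe (π : Rep A H) (a : A) : π.multExt (a : 𝓜(ℂ, A)) = π.toHom a :=
  π.clm_ext fun b v => by
    rw [multExt_apply_apply]; simp

theorem multExt_unique (π : Rep A H) (σ : 𝓜(ℂ, A) →⋆ₐ[ℂ] (H →L[ℂ] H))
    (h : ∀ a : A, σ (a : 𝓜(ℂ, A)) = π.toHom a) : σ = π.multExt := by
  refine StarAlgHom.ext fun m => π.clm_ext fun a v => ?_
  have : m * (a : 𝓜(ℂ, A)) = ((m.fst a : A) : 𝓜(ℂ, A)) := by
    refine DoubleCentralizer.ext _ _ _ _ (Prod.ext ?_ ?_)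
    · refine ContinuousLinearMap.ext fun b => ?_
      have h' (y : A) : y * (m.fst a * b) = y * m.fst (a * b) := by
        rw [← mul_assoc, ← m.central, mul_assoc, m.central]
      have h2 : star (m.fst a * b - m.fst (a * b)) * (m.fst a * b - m.fst (a * b)) = 0 := by
        rw [mul_sub, h', sub_self]
      exact (sub_eq_zero.1 (CStarRing.star_mul_self_eq_zero_iff _ |>.1 h2)).symm
    · refine ContinuousLinearMap.ext fun b => ?_
      exact m.central b a
  rw [multExt_apply_apply, ← h, ← h, ← mul_apply_eq_comp, ← map_mul, this]

/-- The Hilbert space direct sum of a family of nondegenerate representations. -/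
def directSum {ι : Type*} {K : ι → Type*} [∀ i, NormedAddCommGroup (K i)]
    [∀ i, InnerProductSpace ℂ (K i)] [∀ i, CompleteSpace (K i)] (π : ∀ i, Rep A (K i)) :
    Rep A (lp K 2) where
  toHom :=
    { toFun a := lp.mapCLM 2 (fun i => (π i).toHom a) (norm_nonneg a)
        fun i => NonUnitalStarAlgHom.norm_apply_le (π i).toHom a
      map_smul' c a := by ext; simp
      map_zero' := by ext; simp
      map_add' a b := by ext; simp
      map_mul' a b := by ext; simp
      map_star' a := by
        rw [ContinuousLinearMap.star_eq_adjoint, ContinuousLinearMap.eq_adjoint_iff]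
        intro x y
        simp only [lp.inner_eq_tsum]
        refine tsum_congr fun i => ?_
        change ⟪(π i).toHom (star a) (x i), y i⟫_ℂ = ⟪x i, (π i).toHom a (y i)⟫_ℂ
        rw [map_star, ContinuousLinearMap.star_eq_adjoint,
          ContinuousLinearMap.adjoint_inner_left] }
  nondegenerate := by
    rw [isNondegenerate_iff]
    intro v hv
    ext i
    refine (isNondegenerate_iff _).1 (π i).nondegenerate _ fun a => ?_
    exact congrFun (congrArg (fun x : lp K 2 => (x : ∀ i, K i)) (hv a)) i

theorem directSum_apply {ι : Type*} {K : ι → Type*} [∀ i, NormedAddCommGroup (K i)]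
    [∀ i, InnerProductSpace ℂ (K i)] [∀ i, CompleteSpace (K i)] (π : ∀ i, Rep A (K i))
    (a : A) (v : lp K 2) (i : ι) : (directSum π).toHom a v i = (π i).toHom a (v i) := rfl

theorem directSum_multExt_apply {ι : Type*} {K : ι → Type*} [∀ i, NormedAddCommGroup (K i)]
    [∀ i, InnerProductSpace ℂ (K i)] [∀ i, CompleteSpace (K i)] (π : ∀ i, Rep A (K i))
    (m : 𝓜(ℂ, A)) (v : lp K 2) (i : ι) : (directSum π).multExt m v i = (π i).multExt m (v i) := by
  have h : (directSum π).multExt m = lp.mapCLM 2 (fun i => (π i).multExt m) (norm_nonneg m)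
      (fun i => NonUnitalStarAlgHom.norm_apply_le (π i).multExt m) := by
    refine (directSum π).clm_ext fun a v => ?_
    rw [multExt_apply_apply]
    ext i
    rw [directSum_apply, lp.mapCLM_apply_coe, directSum_apply, multExt_apply_apply]
  rw [h]; rfl

/-- The Gelfand-Naimark-Segal representation of a positive functional. -/
def gns [PartialOrder A] [StarOrderedRing A] (f : A →ₚ[ℂ] ℂ) : Rep A f.GNS where
  toHom := f.gnsNonUnitalStarAlgHom
  nondegenerate := by
    have hl := CStarAlgebra.increasingApproximateUnit A
    have : (CStarAlgebra.approximateUnit A).NeBot := hl.neBot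
    have hsub : Set.range ((↑) : f.PreGNS → f.GNS) ⊆
        closure (Submodule.span ℂ {x : f.GNS | ∃ a v, f.gnsNonUnitalStarAlgHom a v = x}) := by
      rintro _ ⟨b, rfl⟩
      refine mem_closure_of_tendsto (f := fun e : A => f.gnsNonUnitalStarAlgHom e (b : f.GNS))
        (b := CStarAlgebra.approximateUnit A) ?_
        (.of_forall fun e => Submodule.subset_span ⟨_, _, rfl⟩)
      simp only [PositiveLinearMap.gnsNonUnitalStarAlgHom_apply_coe]
      refine (UniformSpace.Completion.continuous_coe _).tendsto _ |>.comp ?_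
      rw [tendsto_iff_norm_sub_tendsto_zero]
      have hf : Continuous f := map_continuous f
      have h1 : Continuous fun c : A => √(f (star c * c)).re := by fun_prop
      have h2 : Tendsto (fun e : A => e * f.ofPreGNS b - f.ofPreGNS b)
          (CStarAlgebra.approximateUnit A) (𝓝 0) := by
        simpa using (hl.tendsto_mul_right (f.ofPreGNS b)).sub_const (f.ofPreGNS b)
      have h3 := (h1.tendsto 0).comp h2
      simp only [star_zero, mul_zero, map_zero, Complex.zero_re, Real.sqrt_zero] at h3
      refine h3.congr fun e => ?_
      rw [PositiveLinearMap.preGNS_norm_def]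
      simp
    intro v
    have hd := UniformSpace.Completion.denseRange_coe (α := f.PreGNS) v
    exact closure_minimal hsub isClosed_closure hd

end Rep

end Representations

/-! ### Host algebras -/

/-- A host algebra for `G`: a `C*`-algebra `L` with a homomorphism `η : G → U(M(L))` such that
`g ↦ π̃(η(g))` is strongly continuous for each nondegenerate representation `π` of `L`, and
such that `π ↦ π̃ ∘ η` is injective on `Rep(L, H)` for each Hilbert space `H`. -/
structure IsHostAlgebra {G : Type w} [Group G] [TopologicalSpace G] {L : Type u}
    [NonUnitalCStarAlgebra L] (η : G →* unitary 𝓜(ℂ, L)) : Prop where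
  continuous_rep : ∀ (H : Type u) [NormedAddCommGroup H] [InnerProductSpace ℂ H]
    [CompleteSpace H] (π : Rep L H) (v : H), Continuous fun g => π.multExt (η g) v
  injective_rep : ∀ (H : Type u) [NormedAddCommGroup H] [InnerProductSpace ℂ H]
    [CompleteSpace H],
    Function.Injective fun (π : Rep L H) (g : G) => π.multExt (η g : 𝓜(ℂ, L))

/-! ### States, the universal representation and the enveloping von Neumann algebra -/

section States

variable (C : Type u) [NonUnitalCStarAlgebra C] [PartialOrder C] [StarOrderedRing C]

/-- The states of `C`: positive functionals of norm `1`. -/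
def States := {ω : C →ₚ[ℂ] ℂ // IsLUB ((fun a => ‖ω a‖) '' Metric.closedBall 0 1) 1}

/-- The Hilbert space of the universal representation of `C`. -/
abbrev UnivSpace := lp (fun ω : States C => ω.1.GNS) 2

/-- The universal representation of `C`: the direct sum of the GNS representations of all
states of `C`. -/
def univRep : Rep C (UnivSpace C) := Rep.directSum fun ω : States C => Rep.gns ω.1

/-- The enveloping von Neumann algebra `C**`, realized as the bicommutant of `C` in its universal
representation. It contains `M(C)` through `(univRep C).multExt`. -/
def envelopingVN : VonNeumannAlgebra (UnivSpace C) where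
  toStarSubalgebra := StarSubalgebra.centralizer ℂ
    ((StarSubalgebra.centralizer ℂ (Set.range (univRep C).toHom) :
      StarSubalgebra ℂ (UnivSpace C →L[ℂ] UnivSpace C)) : Set (UnivSpace C →L[ℂ] UnivSpace C))
  centralizer_centralizer' := by
    change Set.centralizer (Set.centralizer (SetLike.coe
      (StarSubalgebra.centralizer ℂ _ : StarSubalgebra ℂ (UnivSpace C →L[ℂ] UnivSpace C)))) =
      SetLike.coe
        (StarSubalgebra.centralizer ℂ _ : StarSubalgebra ℂ (UnivSpace C →L[ℂ] UnivSpace C))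
    rw [StarSubalgebra.coe_centralizer_centralizer, Set.centralizer_centralizer_centralizer]

end States

/-! ### Triples `(C, η_A, η_L)` -/

section Triples

variable {A : Type v} {L C : Type u} [NonUnitalCStarAlgebra A] [NonUnitalCStarAlgebra L]
  [NonUnitalCStarAlgebra C]

/-- `η_A(A) η_L(L) ⊆ C`, and `C` is generated by this set as a `C*`-algebra. -/
structure IsGeneratingTriple (ηA : A →⋆ₙₐ[ℂ] 𝓜(ℂ, C)) (ηL : L →⋆ₙₐ[ℂ] 𝓜(ℂ, C)) : Prop where
  mul_mem : ∀ a l, ∃ c : C, (c : 𝓜(ℂ, C)) = ηA a * ηL l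
  generates : (NonUnitalStarAlgebra.adjoin ℂ
    {c : C | ∃ a l, (c : 𝓜(ℂ, C)) = ηA a * ηL l}).topologicalClosure = ⊤

/-- The hereditary subalgebra `M(C)_L = η_L(L) M(C) η_L(L)` of `M(C)`; a product of sets is the
set of all products of their elements. -/
def multL (ηL : L →⋆ₙₐ[ℂ] 𝓜(ℂ, C)) : Set 𝓜(ℂ, C) :=
  Set.range ηL * Set.univ * Set.range ηL

/-- The hereditary subalgebra `C_L = M(C)_L ∩ C = η_L(L) C η_L(L)` of `C`. -/
def hereditaryL (ηL : L →⋆ₙₐ[ℂ] 𝓜(ℂ, C)) : Set C :=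
  {T : C | (T : 𝓜(ℂ, C)) ∈ multL ηL}

/-- `A_L`: the elements `a` of `A` with `η_A(a) C_L ⊆ C_L` and `η_A(a*) C_L ⊆ C_L`. -/
def subalgebraL (ηA : A →⋆ₙₐ[ℂ] 𝓜(ℂ, C)) (ηL : L →⋆ₙₐ[ℂ] 𝓜(ℂ, C)) : Set A :=
  {a : A | ∀ b ∈ ({a, star a} : Set A), ∀ T ∈ hereditaryL ηL,
    ∃ S ∈ hereditaryL ηL, (S : 𝓜(ℂ, C)) = ηA b * (T : 𝓜(ℂ, C))}

variable {H : Type*} [NormedAddCommGroup H] [InnerProductSpace ℂ H] [CompleteSpace H]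

/-- The homomorphism `ρ̃ ∘ η_L : L → B(H)`. -/
def compHom (ηL : L →⋆ₙₐ[ℂ] 𝓜(ℂ, C)) (ρ : Rep C H) : L →⋆ₙₐ[ℂ] (H →L[ℂ] H) :=
  (ρ.multExt : 𝓜(ℂ, C) →⋆ₙₐ[ℂ] (H →L[ℂ] H)).comp ηL

/-- `ρ` is an `L`-representation of `C` if `ρ̃ ∘ η_L` is nondegenerate. -/
def IsLRep (ηL : L →⋆ₙₐ[ℂ] 𝓜(ℂ, C)) (ρ : Rep C H) : Prop :=
  IsNondegenerate (compHom ηL ρ)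

/-- The unitary representation `U^ρ` of `G` attached to an `L`-representation `ρ` of `C`, that is
`U^ρ(g) = (ρ̃ ∘ η_L)~(η(g))`. It satisfies `U^ρ(g) (ρ̃ ∘ η_L)(l) = (ρ̃ ∘ η_L)(η(g) l)`. -/
def unitaryRep {G : Type w} [Group G] (η : G →* unitary 𝓜(ℂ, L))
    (ηL : L →⋆ₙₐ[ℂ] 𝓜(ℂ, C)) (ρ : Rep C H) (hρ : IsLRep ηL ρ) (g : G) : H →L[ℂ] H :=
  (Rep.mk (compHom ηL ρ) hρ).multExt (η g : 𝓜(ℂ, L))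

theorem unitaryRep_mul_compHom {G : Type w} [Group G] (η : G →* unitary 𝓜(ℂ, L))
    (ηL : L →⋆ₙₐ[ℂ] 𝓜(ℂ, C)) (ρ : Rep C H) (hρ : IsLRep ηL ρ) (g : G) (l : L) :
    unitaryRep η ηL ρ hρ g * compHom ηL ρ l = compHom ηL ρ ((η g : 𝓜(ℂ, L)).fst l) :=
  ContinuousLinearMap.ext fun v => (Rep.mk (compHom ηL ρ) hρ).multExt_apply_apply _ l v

variable [PartialOrder C] [StarOrderedRing C]

/-- The states of `C` whose GNS representation is an `L`-representation. -/
def LStates (ηL : L →⋆ₙₐ[ℂ] 𝓜(ℂ, C)) := {ω : States C // IsLRep ηL (Rep.gns ω.1)}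

/-- The universal `L`-representation `ρ_u` of `C`. -/
def univLRep (ηL : L →⋆ₙₐ[ℂ] 𝓜(ℂ, C)) :
    Rep C (lp (fun ω : LStates ηL => ω.1.1.GNS) 2) :=
  Rep.directSum fun ω : LStates ηL => Rep.gns ω.1.1

theorem univLRep_isLRep (ηL : L →⋆ₙₐ[ℂ] 𝓜(ℂ, C)) : IsLRep ηL (univLRep ηL) := by
  rw [IsLRep, isNondegenerate_iff]
  intro v hv
  ext ω
  refine (isNondegenerate_iff _).1 ω.2 _ fun l => ?_
  have h := congrFun (congrArg (fun x : lp (fun ω : LStates ηL => ω.1.1.GNS) 2 =>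
    (x : ∀ ω : LStates ηL, ω.1.1.GNS)) (hv l)) ω
  have h2 := Rep.directSum_multExt_apply (fun ω : LStates ηL => Rep.gns ω.1.1) (ηL l) v ω
  exact h2.symm.trans h

/-- The covariance condition for a triple: the universal `L`-representation `ρ_u` is faithful and
`U^{ρ_u}(g) ρ̃_u(η_A(a)) U^{ρ_u}(g)* = ρ̃_u(η_A(α_g(a)))`. -/
def CovarianceCondition {G : Type w} [Group G] (η : G →* unitary 𝓜(ℂ, L))
    (α : G →* (A ≃⋆ₐ[ℂ] A)) (ηA : A →⋆ₙₐ[ℂ] 𝓜(ℂ, C)) (ηL : L →⋆ₙₐ[ℂ] 𝓜(ℂ, C)) : Prop :=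
  Function.Injective (univLRep ηL).toHom ∧
  ∀ g a, unitaryRep η ηL (univLRep ηL) (univLRep_isLRep ηL) g *
      (univLRep ηL).multExt (ηA a) *
      star (unitaryRep η ηL (univLRep ηL) (univLRep_isLRep ηL) g) =
    (univLRep ηL).multExt (ηA (α g a))

/-- `P` is the limit in `C**` of `η_L(E_j)`, for every approximate identity `(E_j)` of `L`
(given as a filter `E` on `L`). On `C**` the topology `σ(C**, C*)` is the weak operator topology of
the universal representation. -/
def IsOpenProjection (ηL : L →⋆ₙₐ[ℂ] 𝓜(ℂ, C)) (P : UnivSpace C →L[ℂ] UnivSpace C) : Prop :=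
  P ∈ envelopingVN C ∧ ∀ E : Filter L, E.IsApproximateUnit → ∀ x y : UnivSpace C,
    Tendsto (fun e => ⟪x, (univRep C).multExt (ηL e) y⟫_ℂ) E (𝓝 ⟪x, P y⟫_ℂ)

end Triples

end

end CrossedHost

/-! Everything is measured by P, the projection onto the closed span of η_L(L)H in the universal
representation of C. Cohen's factorization theorem (`exists_factorization`) shows that η_L(L)H and
the right ideal η_L(L)C are already closed. Hence each vector Py has the form η_L(l)w, and η_L(E_j)
→ P strongly for every approximate identity (`tendsto_essProj`). This P lies in the bicommutant and
is the only possible weak limit. In the same way, c ∈ C lies in η_L(L)C exactly when η_L(E_j)c → c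
in norm (`mem_rightIdeal_iff_tendsto`), which links (ii) with (iii).

The characterizations form a cycle, `subalgebraL_tfae`. If A preserves C_L, then D = (1-P)AP
satisfies D c D* = 0 for all c ∈ C, so D = 0; with A* this gives [A, P] = 0. If A commutes with P,
then c = Aη_L(l), which lies in C by (CP4), satisfies Pc = c. The hard step,
`mem_rightIdeal_of_openProj_mul`, turns this weak statement into c ∈ η_L(L)C: a Dini-type
compactness argument on functionals of M(C) forces c*(1-η_L(e))c → 0 in norm. Finally, if Aη_L(L)
and A*η_L(L) lie in η_L(L)C, then multiplying on the right shows that A preserves C_L.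

For (iv), the commutant form yields a closed *-algebra. Invariance under α comes from moving U(g)
through η_L(L) in the faithful covariant representation ρ_u. An α-fixed A commutes with every U(g).
The injectivity in the definition of a host algebra then makes it commute with η_L(L), and the norm
condition of (iii) is immediate. -/

/-! ### Cohen factorization for Banach modules. -/

section Factorization

variable {L B X : Type*} [NonUnitalCStarAlgebra L] [CStarAlgebra B]
  [NormedAddCommGroup X] [NormedSpace ℂ X]

/-- Inversion reverses the order on strictly positive elements, so the lower bound `r` becomes an
upper bound `r⁻¹`. This controls the inverses in Cohen's iteration. -/
theorem CStarAlgebra.norm_ringInverse_le [PartialOrder B] [StarOrderedRing B] {b : B} {r : ℝ}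
    (hr : 0 < r) (hb : algebraMap ℝ B r ≤ b) : IsUnit b ∧ ‖Ring.inverse b‖ ≤ r⁻¹ := by
  have h0 : IsStrictlyPositive (algebraMap ℝ B r) := by
    cfc_tac
  have h1 : IsStrictlyPositive b := h0.of_le hb
  refine ⟨h1.isUnit, ?_⟩
  have h2 := CStarAlgebra.ringInverse_le_ringInverse hb h0
  have h3 : Ring.inverse (algebraMap ℝ B r) = algebraMap ℝ B r⁻¹ := by
    have : algebraMap ℝ B r = (Units.map (algebraMap ℝ B).toMonoidHom (Units.mk0 r hr.ne') : Bˣ) := rfl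
    rw [this, Ring.inverse_unit, ← map_inv]; rfl
  rw [h3] at h2
  have h4 : 0 ≤ Ring.inverse b := by
    obtain ⟨u, hu⟩ := h1.isUnit
    rw [← hu, Ring.inverse_unit]
    exact CFC.inv_nonneg_of_nonneg u (hu ▸ h1.nonneg)
  exact (CStarAlgebra.norm_le_iff_le_algebraMap _ (inv_nonneg.2 hr.le) h4).2 h2

/-- Convergence `T (σ e) x → x` along the canonical approximate unit, on the closed span of `L x`. -/
theorem tendsto_apply_approximateUnit [PartialOrder L] [StarOrderedRing L] (σ : L →⋆ₙₐ[ℂ] B)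
    (T : B →ₐ[ℂ] (X →L[ℂ] X)) (hT : ∀ b, ‖T b‖ ≤ ‖b‖) {x : X}
    (hx : x ∈ closure {z | ∃ l w, T (σ l) w = z}) :
    Tendsto (fun e => T (σ e) x) (CStarAlgebra.approximateUnit L) (𝓝 x) := by
  have hE := CStarAlgebra.increasingApproximateUnit L
  have hc (w : X) : Continuous fun l => T (σ l) w := by
    have h : ∀ l, ‖T (σ l)‖ ≤ 1 * ‖l‖ := fun l => by
      rw [one_mul]; exact (hT _).trans (NonUnitalStarAlgHom.norm_apply_le σ l)
    let S : L →ₗ[ℂ] (X →L[ℂ] X) := T.toLinearMap ∘ₗ (σ : L →ₗ[ℂ] B)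
    exact ((ContinuousLinearMap.apply ℂ X w).continuous.comp (S.mkContinuous 1 h).continuous)
  rw [Metric.tendsto_nhds]
  intro ε hε
  obtain ⟨_, ⟨l, w, rfl⟩, hd⟩ := Metric.mem_closure_iff.1 hx (ε / 3) (by positivity)
  have h1 : Tendsto (fun e => T (σ (e * l)) w) (CStarAlgebra.approximateUnit L)
      (𝓝 (T (σ l) w)) := ((hc w).tendsto l).comp (hE.tendsto_mul_right l)
  filter_upwards [Metric.tendsto_nhds.1 h1 (ε / 3) (by positivity), hE.eventually_norm] with e he hn
  have h2 : dist (T (σ e) x) (T (σ e) (T (σ l) w)) ≤ dist x (T (σ l) w) := by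
    rw [dist_eq_norm, dist_eq_norm, ← map_sub]
    refine ((T (σ e)).le_opNorm _).trans (mul_le_of_le_one_left (norm_nonneg _) ?_)
    exact ((hT _).trans (NonUnitalStarAlgHom.norm_apply_le σ e)).trans hn
  rw [map_mul, map_mul, mul_apply_eq_comp] at he
  have h3 := dist_triangle4 (T (σ e) x) (T (σ e) (T (σ l) w)) (T (σ l) w) x
  rw [dist_comm (T (σ l) w) x] at h3
  linarith

/-- Cohen's factorization theorem: `σ(L) X` is closed in the Banach module `X`. -/
theorem exists_factorization [CompleteSpace X] (σ : L →⋆ₙₐ[ℂ] B)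
    (T : B →ₐ[ℂ] (X →L[ℂ] X)) (hT : ∀ b, ‖T b‖ ≤ ‖b‖) {x : X}
    (hx : x ∈ closure {z | ∃ l w, T (σ l) w = z}) :
    ∃ l y, T (σ l) y = x := by
  let _ := CStarAlgebra.spectralOrder L
  have _ := CStarAlgebra.spectralOrderedRing L
  let _ := CStarAlgebra.spectralOrder B
  have _ := CStarAlgebra.spectralOrderedRing B
  have hE := CStarAlgebra.increasingApproximateUnit L
  have hNe : (CStarAlgebra.approximateUnit L).NeBot := hE.neBot
  -- Cohen's iteration: `b n (a n)` is invertible because of the scalar `r n`, and x = T(b n (a n))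
  -- ξ_n holds at every stage. As n grows the scalar vanishes, so the limit of the first factor lies
  -- in σ(L); it remains to make ξ_n converge although the inverses may blow up.
  let r : ℕ → ℝ := fun n => (1 / 2) ^ n
  have hr (n) : 0 < r n := by positivity
  have hr' (n) : r n = r (n + 1) + r (n + 1) := by simp only [r, pow_succ]; ring
  let b : ℕ → L → B := fun n a => σ a + algebraMap ℝ B (r n)
  have hb (n) (a : L) (ha : 0 ≤ a) : IsUnit (b n a) ∧ ‖Ring.inverse (b n a)‖ ≤ (r n)⁻¹ :=
    CStarAlgebra.norm_ringInverse_le (hr n) (le_add_of_nonneg_left (map_nonneg σ ha))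
  let ξ : ℕ → L → X := fun n a => T (Ring.inverse (b n a)) x
  have hTlim := tendsto_apply_approximateUnit σ T hT hx
  -- Solving T(b) ξ = x for ξ gives r⁻¹(x - T(σ a)ξ). Both terms lie in the closure of σ(L)X, so the
  -- approximate unit also acts as the identity on ξ in the limit.
  have hξ (n) (a : L) (ha : 0 ≤ a) :
      Tendsto (fun e => T (σ e) (ξ n a)) (CStarAlgebra.approximateUnit L) (𝓝 (ξ n a)) := by
    have h1 : T (b n a) (ξ n a) = x := by
      rw [← mul_apply_eq_comp, ← map_mul, Ring.mul_inverse_cancel _ (hb n a ha).1,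
        map_one, one_apply_eq_self]
    have h2 : ξ n a = (r n)⁻¹ • (x - T (σ a) (ξ n a)) := by
      rw [eq_inv_smul_iff₀ (hr n).ne', eq_sub_iff_add_eq']
      refine Eq.trans ?_ h1
      have : T (algebraMap ℝ B (r n)) = r n • 1 := by
        rw [Algebra.algebraMap_eq_smul_one, ← Complex.coe_smul, ← Complex.coe_smul, map_smul,
          map_one]
      simp [b, this]
    have h3 := tendsto_apply_approximateUnit σ T hT (subset_closure ⟨a, ξ n a, rfl⟩)
    have h4 := (hTlim.sub h3).const_smul (r n)⁻¹
    rw [← h2] at h4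
    refine h4.congr fun e => ?_
    conv_rhs => rw [h2]
    rw [← map_sub, ← Complex.coe_smul, ← Complex.coe_smul, map_smul]
  have hstep (n) (a : {a : L // 0 ≤ a}) : ∃ e : {e : L // 0 ≤ e},
      ‖(e : L)‖ ≤ 1 ∧ ‖ξ n a - T (σ e) (ξ n a)‖ ≤ r n := by
    have h1 := Metric.tendsto_nhds.1 (hξ n a a.2) (r n) (hr n)
    obtain ⟨e, h1, h2, h3⟩ := (h1.and (hE.eventually_norm.and hE.eventually_nonneg)).exists
    rw [dist_comm, dist_eq_norm] at h1
    exact ⟨⟨e, h3⟩, h2, h1.le⟩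
  choose F hF1 hF2 using hstep
  let a : ℕ → {a : L // 0 ≤ a} := fun n => Nat.rec (motive := fun _ => {a : L // 0 ≤ a}) ⟨0, le_rfl⟩
    (fun n a => ⟨a + r (n + 1) • (F n a : L),
      add_nonneg a.2 (smul_nonneg (hr _).le (F n a).2)⟩) n
  have ha (n : ℕ) : (a (n + 1) : L) = (a n : L) + r (n + 1) • (F n (a n) : L) := rfl
  have ha1 (n) : dist (a n : L) (a (n + 1)) ≤ (1 / 2) * (1 / 2) ^ n := by
    rw [ha, dist_eq_norm, sub_add_cancel_left, norm_neg, norm_smul, Real.norm_of_nonneg (hr _).le]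
    calc r (n + 1) * _ ≤ r (n + 1) * 1 := by gcongr; exacts [hF1 _ _]
      _ = _ := by simp only [r]; ring
  have hξ1 (n) : dist (ξ n (a n)) (ξ (n + 1) (a (n + 1))) ≤ 1 * (1 / 2) ^ n := by
    have h1 := hb n _ (a n).2
    have h2 := hb (n + 1) _ (a (n + 1)).2
    -- Halving makes the lost scalar r n - r (n+1) equal to the coefficient of the new term. The
    -- factor r (n+1) then cancels the bound on the inverse of `b (n+1)`, leaving only ‖ξ_n - T(σ
    -- F)ξ_n‖ ≤ r n, which is summable.
    have h3 : b n (a n) - b (n + 1) (a (n + 1)) = r (n + 1) • (1 - σ (F n (a n))) := by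
      have : σ (r (n + 1) • (F n (a n) : L)) = r (n + 1) • σ (F n (a n) : L) := by
        rw [← Complex.coe_smul, map_smul, Complex.coe_smul]
      simp only [b, ha, map_add, hr' n, this, Algebra.algebraMap_eq_smul_one]
      module
    have h4 : ξ (n + 1) (a (n + 1)) - ξ n (a n) =
        T (Ring.inverse (b (n + 1) (a (n + 1))))
          (r (n + 1) • (ξ n (a n) - T (σ (F n (a n))) (ξ n (a n)))) := by
      have : r (n + 1) • (ξ n (a n) - T (σ (F n (a n))) (ξ n (a n))) =
          T (b n (a n) - b (n + 1) (a (n + 1))) (ξ n (a n)) := by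
        rw [h3, ← Complex.coe_smul, ← Complex.coe_smul, map_smul]
        simp
      rw [this]
      have key : Ring.inverse (b (n + 1) (a (n + 1))) *
          ((b n (a n) - b (n + 1) (a (n + 1))) * Ring.inverse (b n (a n))) =
          Ring.inverse (b (n + 1) (a (n + 1))) - Ring.inverse (b n (a n)) := by
        rw [sub_mul, mul_sub, ← mul_assoc _ (b (n + 1) _), Ring.inverse_mul_cancel _ h2.1,
          Ring.mul_inverse_cancel _ h1.1, one_mul, mul_one]
      simp only [ξ, ← mul_apply_eq_comp, ← map_mul, key]
      rw [map_sub, sub_apply]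
    rw [dist_comm, dist_eq_norm, h4]
    calc _ ≤ (r (n + 1))⁻¹ * (r (n + 1) * r n) := by
          refine ((T _).le_opNorm _).trans ?_
          rw [norm_smul, Real.norm_of_nonneg (hr _).le]
          gcongr
          · exact (hT _).trans h2.2
          · exact hF2 _ _
      _ = _ := by rw [inv_mul_cancel_left₀ (hr _).ne', one_mul]
  obtain ⟨l, hl⟩ := cauchySeq_tendsto_of_complete
    (cauchySeq_of_le_geometric _ _ (by norm_num) ha1)
  obtain ⟨y, hy⟩ := cauchySeq_tendsto_of_complete
    (cauchySeq_of_le_geometric _ _ (by norm_num) hξ1)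
  refine ⟨l, y, ?_⟩
  have hσ : Continuous σ := map_continuous σ
  have hTc : Continuous T := AddMonoidHomClass.continuous_of_bound T 1 (by simpa using hT)
  have hr0 : Tendsto r atTop (𝓝 0) :=
    tendsto_pow_atTop_nhds_zero_of_lt_one (by norm_num) (by norm_num)
  have hbl : Tendsto (fun n => b n (a n)) atTop (𝓝 (σ l)) := by
    simpa using ((hσ.tendsto l).comp hl).add
      (((algebraMapCLM ℝ B).continuous.tendsto 0).comp hr0)
  have h1 : Tendsto (fun n => T (b n (a n)) (ξ n (a n))) atTop (𝓝 (T (σ l) y)) :=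
    (isBoundedBilinearMap_apply.continuous.tendsto (T (σ l), y)).comp
      (((hTc.tendsto _).comp hbl).prodMk_nhds hy)
  refine tendsto_nhds_unique h1 (tendsto_const_nhds.congr fun n => ?_)
  rw [← mul_apply_eq_comp, ← map_mul, Ring.mul_inverse_cancel _ (hb n _ (a n).2).1,
    map_one, one_apply_eq_self]

end Factorization

/-! ### States of a unital C*-algebra and a Dini-type argument. -/

section Functionals

variable {B : Type*} [CStarAlgebra B] [PartialOrder B] [StarOrderedRing B]

open StarAlgebra in
-- The number ‖x‖ is in the spectrum of x, hence is the value at x of a character of the unital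
-- commutative C*-algebra generated by x. Hahn–Banach extends that character without increasing its
-- norm.
theorem CStarAlgebra.exists_norming_functional [Nontrivial B] {x : B} (hx : 0 ≤ x) :
    ∃ f : StrongDual ℂ B, ‖f‖ ≤ 1 ∧ f 1 = 1 ∧ f x = ‖x‖ := by
  have : IsStarNormal x := hx.isSelfAdjoint.isStarNormal
  have h1 : (‖x‖ : ℂ) ∈ spectrum ℂ x :=
    spectrum.algebraMap_mem ℂ (CStarAlgebra.norm_mem_spectrum_of_nonneg hx)
  obtain ⟨φ, hφ⟩ := (elemental.bijective_characterSpaceToSpectrum x).2 ⟨_, h1⟩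
  have hφ' : φ ⟨x, elemental.self_mem ℂ x⟩ = ‖x‖ := congrArg Subtype.val hφ
  have hn (y : elemental ℂ x) : ‖φ y‖ ≤ ‖y‖ := AlgHom.norm_apply_le_self φ y
  let g : StrongDual ℂ (elemental ℂ x).toSubalgebra.toSubmodule :=
    LinearMap.mkContinuous
      { toFun := fun y => φ y
        map_add' := fun y z => map_add φ _ _
        map_smul' := fun c y => map_smul φ c _ } 1 fun y => by
      rw [one_mul]
      exact hn y
  obtain ⟨f, hf, hfn⟩ := exists_extension_norm_eq _ g
  refine ⟨f, hfn ▸ LinearMap.mkContinuous_norm_le _ zero_le_one _, ?_, ?_⟩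
  · exact (hf ⟨1, one_mem (elemental ℂ x)⟩).trans (map_one φ)
  · exact (hf ⟨x, elemental.self_mem ℂ x⟩).trans hφ'

/-- The real part is bounded below by testing f on ‖x‖ - x, whose norm is at most ‖x‖. The imaginary
part is killed by testing f on x + it for all real t: the square of the norm grows only like t²,
leaving no room for a term linear in t. -/
theorem CStarAlgebra.nonneg_apply_of_norm_le_one {f : StrongDual ℂ B} (hf : ‖f‖ ≤ 1) (h1 : f 1 = 1)
    {x : B} (hx : 0 ≤ x) : 0 ≤ f x := by
  have hle (y : B) : ‖f y‖ ≤ ‖y‖ := f.le_of_opNorm_le_of_le hf le_rfl |>.trans (by simp)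
  have : Nontrivial B := ⟨1, 0, fun h => by simp [h] at h1⟩
  rw [Complex.nonneg_iff]
  constructor
  · have h2 := hle (algebraMap ℝ B ‖x‖ - x)
    have h3 : ‖algebraMap ℝ B ‖x‖ - x‖ ≤ ‖x‖ := by
      rw [CStarAlgebra.norm_le_iff_le_algebraMap _ (norm_nonneg x)
        (sub_nonneg.2 hx.isSelfAdjoint.le_algebraMap_norm_self)]
      exact sub_le_self _ hx
    have h4 : f (algebraMap ℝ B ‖x‖) = ‖x‖ := by
      rw [Algebra.algebraMap_eq_smul_one, ← Complex.coe_smul, map_smul, h1]; simp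
    rw [map_sub, h4] at h2
    have h5 := (Complex.re_le_norm _).trans (h2.trans h3)
    simp only [Complex.sub_re, Complex.ofReal_re] at h5
    linarith
  · have key (t : ℝ) : ((f x).im + t) ^ 2 ≤ ‖x‖ ^ 2 + t ^ 2 := by
      set y : B := x + (Complex.I * t) • (1 : B) with hy
      have h2 : f y = f x + Complex.I * t := by simp [hy, h1]
      have h3 : star y * y = x * x + (t ^ 2 : ℝ) • (1 : B) := by
        rw [hy, star_add, hx.isSelfAdjoint.star_eq, star_smul, star_one, ← Complex.coe_smul]
        simp only [add_mul, mul_add, smul_mul_assoc, mul_smul_comm, one_mul, mul_one, smul_add,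
          smul_smul]
        have : star (Complex.I * t) = - (Complex.I * t) := by simp
        rw [this]
        have h4 : (Complex.I * t) * -(Complex.I * t) = ((t ^ 2 : ℝ) : ℂ) := by
          push_cast; linear_combination (-t ^ 2) * Complex.I_sq
        rw [h4]; module
      have h4 : ‖y‖ ^ 2 ≤ ‖x‖ ^ 2 + t ^ 2 := by
        rw [sq ‖y‖, ← CStarRing.norm_star_mul_self, h3]
        refine (norm_add_le _ _).trans ?_
        gcongr
        · exact (norm_mul_le _ _).trans_eq (sq _).symm
        · rw [norm_smul, CStarRing.norm_one, mul_one, Real.norm_of_nonneg (sq_nonneg t)]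
      have h5 : ((f x).im + t) ^ 2 ≤ ‖f y‖ ^ 2 := by
        have := Complex.abs_im_le_norm (f y)
        rw [h2] at this ⊢
        simp only [Complex.add_im, Complex.mul_im, Complex.I_re, Complex.I_im, Complex.ofReal_im,
          Complex.ofReal_re, zero_mul, one_mul, zero_add] at this
        exact sq_le_sq' (by linarith [neg_abs_le ((f x).im + t)]) ((le_abs_self _).trans this)
      exact h5.trans ((pow_le_pow_left₀ (norm_nonneg _) (hle y) 2).trans h4)
    by_contra hne
    -- This t makes the cross term 2t·Im f(x) equal to ‖x‖² + 1, one more than the bound allows.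
    have h6 := key ((‖x‖ ^ 2 + 1) / (2 * (f x).im))
    have hne' : (f x).im ≠ 0 := fun h => hne h.symm
    have h7 : (2 * (f x).im) * ((‖x‖ ^ 2 + 1) / (2 * (f x).im)) = ‖x‖ ^ 2 + 1 := by field_simp
    nlinarith [sq_nonneg (f x).im]

/-- A compactness argument on the state space, in the spirit of Dini's theorem: if a decreasing
family does not tend to `0` in norm, a single state stays away from `0` on it. -/
theorem CStarAlgebra.exists_functional_ge {ι : Type*} {l : Filter ι} {x : ι → B} {ε : ℝ}
    (hε : 0 < ε) (h0 : ∀ᶠ i in l, 0 ≤ x i) (hx : ∃ᶠ i in l, ε ≤ ‖x i‖) :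
    ∃ f : StrongDual ℂ B, ‖f‖ ≤ 1 ∧ f 1 = 1 ∧
      ∀ i, (∀ᶠ j in l, x j ≤ x i) → ε ≤ (f (x i)).re := by
  obtain ⟨i₀, hi₀⟩ := hx.exists
  have : Nontrivial B := ⟨x i₀, 0, fun h => by rw [h, norm_zero] at hi₀; linarith⟩
  have hchoose (i) : ∃ f : StrongDual ℂ B, ‖f‖ ≤ 1 ∧ f 1 = 1 ∧ (0 ≤ x i → f (x i) = ‖x i‖) := by
    by_cases h : 0 ≤ x i
    · obtain ⟨f, h1, h2, h3⟩ := exists_norming_functional h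
      exact ⟨f, h1, h2, fun _ => h3⟩
    · obtain ⟨f, h1, h2, h3⟩ := exists_norming_functional (le_refl (0 : B))
      exact ⟨f, h1, h2, fun h' => (h h').elim⟩
  choose F hF1 hF2 hF3 using hchoose
  have hNe : (l ⊓ 𝓟 {i | ε ≤ ‖x i‖}).NeBot := frequently_mem_iff_neBot.1 hx
  -- The required functional is the weak-* limit along U of functionals F j norming x j, which
  -- exists by Banach–Alaoglu. For fixed i, positivity gives F j (x i) ≥ F j (x j) = ‖x j‖ ≥ ε for
  -- U-almost all j, and this passes to the limit.
  let U : Ultrafilter ι := Ultrafilter.of (l ⊓ 𝓟 {i | ε ≤ ‖x i‖})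
  have hU : (U : Filter ι) ≤ l ⊓ 𝓟 {i | ε ≤ ‖x i‖} := Ultrafilter.of_le _
  have hUl : (U : Filter ι) ≤ l := hU.trans inf_le_left
  have hUε : ∀ᶠ i in (U : Filter ι), ε ≤ ‖x i‖ :=
    (hU.trans inf_le_right) (mem_principal_self _)
  obtain ⟨g, hg1, hg2⟩ :=
    (WeakDual.isCompact_closedBall (𝕜 := ℂ) (0 : StrongDual ℂ B) 1).ultrafilter_le_nhds
    (U.map fun i => StrongDual.toWeakDual (F i)) (by
      rw [Ultrafilter.coe_map, le_principal_iff, mem_map]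
      exact univ_mem' fun i => by simpa using hF1 i)
  have hlim (y : B) : Tendsto (fun i => F i y) U (𝓝 (g y)) :=
    ((WeakDual.eval_continuous y).tendsto g).comp hg2
  refine ⟨WeakDual.toStrongDual g, by simpa using hg1, ?_, fun i hi => ?_⟩
  · exact tendsto_nhds_unique (hlim 1) (by simp [hF2])
  · refine ge_of_tendsto ((Complex.continuous_re.tendsto _).comp (hlim (x i))) ?_
    filter_upwards [hUl hi, hUl h0, hUε] with j h1 h2 h3
    have h4 := nonneg_apply_of_norm_le_one (hF1 j) (hF2 j) (sub_nonneg.2 h1)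
    rw [map_sub, hF3 j h2, Complex.nonneg_iff] at h4
    simp only [Complex.sub_re, Complex.ofReal_re] at h4
    simp only [Function.comp_apply]
    linarith

end Functionals

namespace CrossedHost

/-! ### Multipliers and the right ideal σ(L)C. -/

section Multipliers

variable {C : Type*} [NonUnitalCStarAlgebra C]

theorem norm_coe_multiplier (c : C) : ‖(c : 𝓜(ℂ, C))‖ = ‖c‖ := by
  rw [← DoubleCentralizer.norm_fst, DoubleCentralizer.coe_fst,
    ContinuousLinearMap.opNorm_mul_apply]

theorem coe_multiplier_injective : Function.Injective fun c : C => (c : 𝓜(ℂ, C)) := by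
  intro a b h
  have h1 : ((a - b : C) : 𝓜(ℂ, C)) = 0 := by
    have := map_sub (DoubleCentralizer.coeHom (𝕜 := ℂ) (A := C)) a b
    simp only [DoubleCentralizer.coeHom_apply] at this
    rw [this, sub_eq_zero]
    exact h
  rw [← sub_eq_zero, ← norm_eq_zero, ← norm_coe_multiplier, h1, norm_zero]

/-- Multiplying on the left by any y and using the centralizer identity makes the two sides agree,
so their difference z satisfies z*z = 0. -/
theorem fst_apply_mul (m : 𝓜(ℂ, C)) (a b : C) : m.fst a * b = m.fst (a * b) := by
  have h (y : C) : y * (m.fst a * b) = y * m.fst (a * b) := by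
    rw [← mul_assoc, ← m.central, mul_assoc, m.central]
  have h2 : star (m.fst a * b - m.fst (a * b)) * (m.fst a * b - m.fst (a * b)) = 0 := by
    rw [mul_sub, h, sub_self]
  exact sub_eq_zero.1 (CStarRing.star_mul_self_eq_zero_iff _ |>.1 h2)

theorem multiplier_mul_coe (m : 𝓜(ℂ, C)) (c : C) :
    m * (c : 𝓜(ℂ, C)) = ((m.fst c : C) : 𝓜(ℂ, C)) :=
  DoubleCentralizer.ext _ _ _ _ (Prod.ext
    (ContinuousLinearMap.ext fun b => (fst_apply_mul m c b).symm)
    (ContinuousLinearMap.ext fun b => m.central b c))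

theorem coe_mul_multiplier (m : 𝓜(ℂ, C)) (c : C) :
    (c : 𝓜(ℂ, C)) * m = ((m.snd c : C) : 𝓜(ℂ, C)) := by
  have h := congrArg star (multiplier_mul_coe (star m) (star c))
  have hs (a : C) : star (a : 𝓜(ℂ, C)) = ((star a : C) : 𝓜(ℂ, C)) :=
    (map_star (DoubleCentralizer.coeHom (𝕜 := ℂ) (A := C)) a).symm
  rw [star_mul, star_star, hs, hs, star_star, DoubleCentralizer.star_fst, star_star, star_star] at h
  exact h

theorem coe_multiplier_mul (a b : C) : ((a * b : C) : 𝓜(ℂ, C)) = (a : 𝓜(ℂ, C)) * (b : 𝓜(ℂ, C)) :=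
  map_mul (DoubleCentralizer.coeHom (𝕜 := ℂ) (A := C)) a b

theorem coe_multiplier_sub (a b : C) : ((a - b : C) : 𝓜(ℂ, C)) = (a : 𝓜(ℂ, C)) - (b : 𝓜(ℂ, C)) :=
  map_sub (DoubleCentralizer.coeHom (𝕜 := ℂ) (A := C)) a b

theorem coe_multiplier_star (a : C) : ((star a : C) : 𝓜(ℂ, C)) = star (a : 𝓜(ℂ, C)) :=
  map_star (DoubleCentralizer.coeHom (𝕜 := ℂ) (A := C)) a

/-- The action of the multiplier algebra by left multiplication. -/
noncomputable def multiplierAction : 𝓜(ℂ, C) →ₐ[ℂ] (C →L[ℂ] C) where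
  toFun m := m.fst
  map_one' := rfl
  map_mul' _ _ := rfl
  map_zero' := rfl
  map_add' _ _ := rfl
  commutes' _ := rfl

variable {L : Type*} [NonUnitalCStarAlgebra L]

/-- The right ideal `σ(L) C` of `C`. -/
def rightIdeal (σ : L →⋆ₙₐ[ℂ] 𝓜(ℂ, C)) : Set C :=
  {c | ∃ l c', (σ l).fst c' = c}

theorem exists_isApproximateUnit (L : Type*) [NonUnitalCStarAlgebra L] :
    ∃ E : Filter L, E.IsApproximateUnit :=
  let _ := CStarAlgebra.spectralOrder L
  have _ := CStarAlgebra.spectralOrderedRing L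
  ⟨_, (CStarAlgebra.increasingApproximateUnit L).toIsApproximateUnit⟩

theorem mem_rightIdeal_of_mem_closure {σ : L →⋆ₙₐ[ℂ] 𝓜(ℂ, C)} {c : C}
    (hc : c ∈ closure (rightIdeal σ)) : c ∈ rightIdeal σ := by
  exact exists_factorization σ multiplierAction (fun m => (DoubleCentralizer.norm_fst m).le) hc

/-- An exact factorization c = σ(l)c' reduces convergence to el → l, so no bound on the approximate
identity is needed. Conversely, convergence puts c in the closure, and by Cohen's theorem the ideal
is closed. -/
theorem mem_rightIdeal_iff_tendsto {σ : L →⋆ₙₐ[ℂ] 𝓜(ℂ, C)} {E : Filter L}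
    (hE : E.IsApproximateUnit) {c : C} :
    c ∈ rightIdeal σ ↔ Tendsto (fun e => (σ e).fst c) E (𝓝 c) := by
  constructor
  · rintro ⟨l, c', rfl⟩
    have h1 : Continuous fun l => (σ l).fst c' := by
      have h : ∀ l, ‖(σ l).fst‖ ≤ 1 * ‖l‖ := fun l => by
        rw [one_mul, DoubleCentralizer.norm_fst]; exact NonUnitalStarAlgHom.norm_apply_le σ l
      let S : L →ₗ[ℂ] (C →L[ℂ] C) := multiplierAction.toLinearMap ∘ₗ (σ : L →ₗ[ℂ] 𝓜(ℂ, C))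
      exact (ContinuousLinearMap.apply ℂ C c').continuous.comp (S.mkContinuous 1 h).continuous
    refine ((h1.tendsto l).comp (hE.tendsto_mul_right l)).congr fun e => ?_
    simp only [Function.comp_apply, map_mul, DoubleCentralizer.mul_fst, mul_apply_eq_comp]
  · intro h
    have := hE.neBot
    exact mem_rightIdeal_of_mem_closure (mem_closure_of_tendsto h (.of_forall fun e => ⟨e, c, rfl⟩))

theorem mem_hereditaryL {L C : Type u} [NonUnitalCStarAlgebra L] [NonUnitalCStarAlgebra C]
    {σ : L →⋆ₙₐ[ℂ] 𝓜(ℂ, C)} {T : C} :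
    T ∈ hereditaryL σ ↔ ∃ l m l', σ l * m * σ l' = (T : 𝓜(ℂ, C)) := by
  simp only [hereditaryL, multL, Set.mem_mul, Set.mem_range, Set.mem_univ, true_and, Set.mem_ofPred_eq]
  constructor
  · rintro ⟨_, ⟨_, ⟨l, rfl⟩, m, rfl⟩, _, ⟨l', rfl⟩, h⟩
    exact ⟨l, m, l', h⟩
  · rintro ⟨l, m, l', h⟩
    exact ⟨_, ⟨_, ⟨l, rfl⟩, m, rfl⟩, _, ⟨l', rfl⟩, h⟩

end Multipliers

/-! ### The essential projection of a possibly degenerate representation. -/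

section EssentialProjection

variable {L : Type*} [NonUnitalCStarAlgebra L]
variable {H : Type*} [NormedAddCommGroup H] [InnerProductSpace ℂ H] [CompleteSpace H]

/-- The projection onto the closed span of `π(L) H`. -/
noncomputable def essProj (π : L →⋆ₙₐ[ℂ] (H →L[ℂ] H)) : H →L[ℂ] H :=
  (Submodule.span ℂ {x : H | ∃ l v, π l v = x}).topologicalClosure.starProjection

theorem isStarProjection_essProj (π : L →⋆ₙₐ[ℂ] (H →L[ℂ] H)) : IsStarProjection (essProj π) :=
  isStarProjection_starProjection

theorem essProj_mul (π : L →⋆ₙₐ[ℂ] (H →L[ℂ] H)) (l : L) : essProj π * π l = π l :=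
  ContinuousLinearMap.ext fun v => Submodule.starProjection_eq_self_iff.2
    (subset_closure (Submodule.subset_span ⟨l, v, rfl⟩))

theorem mul_essProj (π : L →⋆ₙₐ[ℂ] (H →L[ℂ] H)) (l : L) : π l * essProj π = π l := by
  have h := congrArg star (essProj_mul π (star l))
  rwa [star_mul, (isStarProjection_essProj π).isSelfAdjoint.star_eq, ← map_star, star_star] at h

theorem exists_apply_eq_essProj (π : L →⋆ₙₐ[ℂ] (H →L[ℂ] H)) (y : H) :
    ∃ l w, π l w = essProj π y := by
  let _ := CStarAlgebra.spectralOrder L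
  have _ := CStarAlgebra.spectralOrderedRing L
  have hE := CStarAlgebra.increasingApproximateUnit L
  have hNe : (CStarAlgebra.approximateUnit L).NeBot := hE.neBot
  -- The factorization theorem speaks of the closure of single products, not of their span. Each x
  -- in the span is the limit of the single products π(e)x, so the two closures agree.
  have hsub : closure (Submodule.span ℂ {x : H | ∃ l v, π l v = x} : Set H) ⊆
      closure {x : H | ∃ l v, π l v = x} := by
    refine closure_minimal (fun x hx => ?_) isClosed_closure
    have hx' : Tendsto (fun e => π e x) (CStarAlgebra.approximateUnit L) (𝓝 x) := by
      induction hx using Submodule.span_induction with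
      | mem x hx =>
        exact tendsto_apply_approximateUnit π (AlgHom.id ℂ _) (fun _ => le_rfl) (subset_closure hx)
      | zero => simp
      | add x y _ _ hx hy => simpa using hx.add hy
      | smul c x _ hx => simpa using hx.const_smul c
    exact mem_closure_of_tendsto hx' (.of_forall fun e => ⟨e, x, rfl⟩)
  exact exists_factorization π (AlgHom.id ℂ _) (fun _ => le_rfl)
    (hsub (Submodule.starProjection_apply_mem
      (Submodule.span ℂ {x : H | ∃ l v, π l v = x}).topologicalClosure y))

/-- Since π(e) kills the complement of the range of the projection, only Py matters. Writing Py =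
π(l)w exactly gives π(e)y = π(el)w, so an arbitrary, possibly unbounded, approximate identity
converges strongly. -/
theorem tendsto_essProj (π : L →⋆ₙₐ[ℂ] (H →L[ℂ] H)) {E : Filter L} (hE : E.IsApproximateUnit)
    (y : H) : Tendsto (fun e => π e y) E (𝓝 (essProj π y)) := by
  obtain ⟨l, w, h⟩ := exists_apply_eq_essProj π y
  have hc : Continuous fun l => π l w :=
    (ContinuousLinearMap.apply ℂ H w).continuous.comp <|
      AddMonoidHomClass.continuous_of_bound π 1
        (by simpa only [one_mul] using! NonUnitalStarAlgHom.norm_apply_le π)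
  rw [← h]
  refine ((hc.tendsto l).comp (hE.tendsto_mul_right l)).congr fun e => ?_
  simp only [Function.comp_apply]
  rw [map_mul, mul_apply_eq_comp, h, ← mul_apply_eq_comp, mul_essProj]

end EssentialProjection

section Representations

variable {C : Type*} [NonUnitalCStarAlgebra C]
variable {H : Type*} [NormedAddCommGroup H] [InnerProductSpace ℂ H] [CompleteSpace H]

theorem Rep.commute_multExt (π : Rep C H) {T : H →L[ℂ] H} (hT : ∀ c, T * π.toHom c = π.toHom c * T)
    (m : 𝓜(ℂ, C)) : T * π.multExt m = π.multExt m * T :=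
  π.clm_ext fun a v => by
    have h (c : C) (v : H) : T (π.toHom c v) = π.toHom c (T v) := congrArg (· v) (hT c)
    simp only [mul_apply_eq_comp, Rep.multExt_apply_apply, h]

theorem Rep.multExt_injective (π : Rep C H) (hπ : Function.Injective π.toHom) :
    Function.Injective π.multExt := by
  intro m n h
  have h1 : m.fst = n.fst := ContinuousLinearMap.ext fun c => hπ <|
    ContinuousLinearMap.ext fun v => by
      rw [← π.multExt_apply_apply, ← π.multExt_apply_apply, h]
  rw [← sub_eq_zero, ← norm_eq_zero, ← DoubleCentralizer.norm_fst, DoubleCentralizer.sub_fst, h1,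
    sub_self, norm_zero]

end Representations

/-! ### The projection P in the enveloping von Neumann algebra. -/

section OpenProjection

variable {A : Type v} {L C : Type u} [NonUnitalCStarAlgebra A] [NonUnitalCStarAlgebra L]
  [NonUnitalCStarAlgebra C] [PartialOrder C] [StarOrderedRing C]

/-- The open projection of `η_L` in the enveloping von Neumann algebra. -/
noncomputable abbrev openProj (ηL : L →⋆ₙₐ[ℂ] 𝓜(ℂ, C)) : UnivSpace C →L[ℂ] UnivSpace C :=
  essProj (compHom ηL (univRep C))

/-- The commutant of C also commutes with the multipliers, hence with their strong limit, which
places the projection in the bicommutant. Weak convergence follows from strong convergence. -/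
theorem isOpenProjection_openProj (ηL : L →⋆ₙₐ[ℂ] 𝓜(ℂ, C)) : IsOpenProjection ηL (openProj ηL) := by
  refine ⟨?_, fun E hE x y => ?_⟩
  · have h : openProj ηL ∈ StarSubalgebra.centralizer ℂ
        ((StarSubalgebra.centralizer ℂ (Set.range (univRep C).toHom) :
          StarSubalgebra ℂ (UnivSpace C →L[ℂ] UnivSpace C)) :
            Set (UnivSpace C →L[ℂ] UnivSpace C)) := by
      have key (T) (hT : T ∈ StarSubalgebra.centralizer ℂ (Set.range (univRep C).toHom)) :
          T * openProj ηL = openProj ηL * T := by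
        rw [StarSubalgebra.mem_centralizer_iff] at hT
        have h1 := (univRep C).commute_multExt fun c => (hT _ ⟨c, rfl⟩).1.symm
        obtain ⟨E, hE⟩ := exists_isApproximateUnit L
        have := hE.neBot
        refine ContinuousLinearMap.ext fun v => ?_
        refine tendsto_nhds_unique ((T.continuous.tendsto _).comp (tendsto_essProj _ hE v))
          ((tendsto_essProj _ hE (T v)).congr fun e => ?_)
        exact (congrArg (· v) (h1 (ηL e))).symm
      rw [StarSubalgebra.mem_centralizer_iff]
      exact fun T hT => ⟨key T hT, key _ (star_mem hT)⟩
    exact h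
  · exact ((innerSL ℂ x).continuous.tendsto _).comp
      (tendsto_essProj (compHom ηL (univRep C)) hE y)

theorem IsOpenProjection.eq_openProj {ηL : L →⋆ₙₐ[ℂ] 𝓜(ℂ, C)} {P : UnivSpace C →L[ℂ] UnivSpace C}
    (hP : IsOpenProjection ηL P) : P = openProj ηL := by
  obtain ⟨E, hE⟩ := exists_isApproximateUnit L
  have := hE.neBot
  exact ContinuousLinearMap.ext fun y => ext_inner_left ℂ fun x =>
    tendsto_nhds_unique (hP.2 E hE x y) ((isOpenProjection_openProj ηL).2 E hE x y)

omit [PartialOrder C] [StarOrderedRing C] in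
/-- Elements of `A_L` leave the range of the open projection invariant. -/
theorem commute_essProj_of_mem_subalgebraL {H : Type*} [NormedAddCommGroup H]
    [InnerProductSpace ℂ H] [CompleteSpace H] (π : Rep C H) {ηA : A →⋆ₙₐ[ℂ] 𝓜(ℂ, C)} {ηL : L →⋆ₙₐ[ℂ] 𝓜(ℂ, C)}
    {a : A} (ha : a ∈ subalgebraL ηA ηL) :
    Commute (π.multExt (ηA a)) (essProj (compHom ηL π)) := by
  set P := essProj (compHom ηL π)
  have hP : IsStarProjection P := isStarProjection_essProj _
  have hσP (l : L) : P * π.multExt (ηL l) = π.multExt (ηL l) := essProj_mul _ l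
  obtain ⟨E, hE⟩ := exists_isApproximateUnit L
  have := hE.neBot
  have key (b : A) (hb : b ∈ ({a, star a} : Set A)) :
      (1 - P) * π.multExt (ηA b) * P = 0 := by
    -- D is an off-diagonal corner. The elements σ(l) c σ(l') lie in C_L, so b maps them to elements
    -- whose range lies in that of P, where 1 - P vanishes. Letting l and then l' run through an
    -- approximate identity replaces both by P.
    set D := (1 - P) * π.multExt (ηA b) * P with hD
    have hDP : D * P = D := by rw [hD, mul_assoc, hP.isIdempotentElem.eq]
    have h1 (c : C) (l l' : L) :
        (1 - P) * π.multExt (ηA b) * (π.multExt (ηL l) * π.toHom c * π.multExt (ηL l')) = 0 := by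
      have hT : ηL l * (c : 𝓜(ℂ, C)) * ηL l' =
          (((ηL l').snd ((ηL l).fst c) : C) : 𝓜(ℂ, C)) := by
        rw [multiplier_mul_coe, coe_mul_multiplier]
      obtain ⟨S, hS, hS'⟩ := ha b hb _ (mem_hereditaryL.2 ⟨l, c, l', hT⟩)
      obtain ⟨k, m, k', hk⟩ := mem_hereditaryL.1 hS
      rw [← hT, ← hk] at hS'
      have h2 := congrArg π.multExt hS'
      simp only [map_mul, Rep.multExt_coe] at h2
      rw [mul_assoc (1 - P), ← h2, ← mul_assoc, ← mul_assoc, sub_mul, one_mul, hσP, sub_self,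
        zero_mul, zero_mul]
    have h2 (c : C) (l' : L) : D * π.toHom c * π.multExt (ηL l') = 0 := by
      refine ContinuousLinearMap.ext fun v => ?_
      have h3 := (((1 - P) * π.multExt (ηA b)).continuous.tendsto _).comp
        (tendsto_essProj (compHom ηL π) hE (π.toHom c (π.multExt (ηL l') v)))
      refine tendsto_nhds_unique h3 (tendsto_const_nhds.congr fun e => ?_)
      exact (congrArg (· v) (h1 c e l')).symm
    have h3 (c : C) : D * π.toHom c * star D = 0 := by
      have h4 : D * π.toHom c * P = 0 := by
        refine ContinuousLinearMap.ext fun v => ?_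
        have h3 := ((D * π.toHom c).continuous.tendsto _).comp
          (tendsto_essProj (compHom ηL π) hE v)
        refine tendsto_nhds_unique h3 (tendsto_const_nhds.congr fun e => ?_)
        exact (congrArg (· v) (h2 c e)).symm
      have h5 : star D = P * star D := by
        conv_lhs => rw [← hDP, star_mul, hP.isSelfAdjoint.star_eq]
      rw [h5, ← mul_assoc, h4, zero_mul]
    -- Apply D c D* = 0 to c*c, which is the square (cD*)*(cD*). Nondegeneracy then removes c.
    have h4 (c : C) : π.toHom c * star D = 0 := by
      rw [← CStarRing.star_mul_self_eq_zero_iff, star_mul, star_star, ← map_star, mul_assoc,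
        ← mul_assoc (π.toHom _), ← map_mul, ← mul_assoc, h3]
    have h5 : star D = 0 := ContinuousLinearMap.ext fun v =>
      (isNondegenerate_iff _).1 π.nondegenerate _ fun c => congrArg (· v) (h4 c)
    rwa [star_eq_zero] at h5
  have h1 := key a (by simp)
  have h2 := congrArg star (key (star a) (by simp))
  simp only [star_mul, star_sub, star_one, hP.isSelfAdjoint.star_eq, star_zero, ← map_star,
    star_star] at h2
  rw [sub_mul, sub_mul, one_mul, sub_eq_zero] at h1
  rw [mul_sub, mul_one, mul_sub, sub_eq_zero] at h2
  exact h1.trans ((mul_assoc _ _ _).trans h2.symm)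

end OpenProjection


/-! ### GNS vectors and restriction of functionals from M(C) to C. -/

section GNSVectors

variable {C : Type*} [NonUnitalCStarAlgebra C] [PartialOrder C] [StarOrderedRing C]

/-- The canonical map of `C` into the GNS space of a positive functional. -/
noncomputable def gnsVec (f : C →ₚ[ℂ] ℂ) : C →ₗ[ℂ] f.GNS :=
  (UniformSpace.Completion.toComplL (𝕜 := ℂ) (E := f.PreGNS)).toLinearMap ∘ₗ
    f.toPreGNS.toLinearMap

theorem inner_gnsVec (f : C →ₚ[ℂ] ℂ) (a b : C) : ⟪gnsVec f a, gnsVec f b⟫_ℂ = f (star a * b) :=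
  UniformSpace.Completion.inner_coe _ _

theorem continuous_gnsVec (f : C →ₚ[ℂ] ℂ) : Continuous (gnsVec f) := by
  refine continuous_of_continuousAt_zero (gnsVec f) ?_
  have hf : Continuous f := map_continuous f
  have h1 : Continuous fun c : C => √(f (star c * c)).re := by fun_prop
  have h2 := h1.tendsto 0
  simp only [star_zero, mul_zero, map_zero, Complex.zero_re, Real.sqrt_zero] at h2
  rw [ContinuousAt, map_zero, tendsto_zero_iff_norm_tendsto_zero]
  refine h2.congr fun c => ?_
  rw [← inner_gnsVec, inner_self_eq_norm_sq_to_K, ← RCLike.ofReal_pow]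
  exact Real.sqrt_sq (norm_nonneg _)

theorem gns_toHom_gnsVec (f : C →ₚ[ℂ] ℂ) (a b : C) :
    (Rep.gns f).toHom a (gnsVec f b) = gnsVec f (a * b) :=
  f.gnsNonUnitalStarAlgHom_apply_coe

/-- The multiplier extension is only prescribed on vectors π(b)v. The vector of b is a limit of such
vectors, because be → b along an approximate identity of C. -/
theorem gns_multExt_gnsVec (f : C →ₚ[ℂ] ℂ) (m : 𝓜(ℂ, C)) (b : C) :
    (Rep.gns f).multExt m (gnsVec f b) = gnsVec f (m.fst b) := by
  obtain ⟨E, hE⟩ := exists_isApproximateUnit C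
  have := hE.neBot
  have h1 := ((((Rep.gns f).multExt m).continuous.comp (continuous_gnsVec f)).tendsto b).comp
    (hE.tendsto_mul_left b)
  have h2 := ((continuous_gnsVec f).tendsto (m.fst b)).comp (hE.tendsto_mul_left (m.fst b))
  refine tendsto_nhds_unique h1 (h2.congr fun e => ?_)
  simp only [Function.comp_apply]
  rw [← gns_toHom_gnsVec, ← gns_toHom_gnsVec, Rep.multExt_apply_apply]

theorem isLUB_norm_apply {E : Type*} [NormedAddCommGroup E] [NormedSpace ℂ E] (g : StrongDual ℂ E) :
    IsLUB ((fun a => ‖g a‖) '' Metric.closedBall 0 1) ‖g‖ := by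
  rw [← g.sSup_unitClosedBall_eq_norm]
  refine isLUB_csSup (⟨_, 0, by simp, rfl⟩) ⟨‖g‖, ?_⟩
  rintro _ ⟨a, ha, rfl⟩
  exact g.le_of_opNorm_le_of_le le_rfl (by simpa using ha) |>.trans (by simp)

/-- A positive functional of the form `f|_C` is a multiple of a state. -/
theorem exists_state_smul_eq {f : StrongDual ℂ 𝓜(ℂ, C)} (hf : ‖f‖ ≤ 1) (h1 : f 1 = 1)
    (hne : ∃ c : C, f c ≠ 0) :
    ∃ (ω : States C) (r : ℝ), ∀ c : C, f c = r * ω.1 c := by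
  let _ := CStarAlgebra.spectralOrder 𝓜(ℂ, C)
  have _ := CStarAlgebra.spectralOrderedRing 𝓜(ℂ, C)
  have hpos (c : C) (hc : 0 ≤ c) : 0 ≤ f c :=
    CStarAlgebra.nonneg_apply_of_norm_le_one hf h1
      (map_nonneg (DoubleCentralizer.coeHom (𝕜 := ℂ) (A := C)) hc)
  let g : StrongDual ℂ C := f.comp
    ((DoubleCentralizer.coeHom (𝕜 := ℂ) (A := C) : C →ₗ[ℂ] 𝓜(ℂ, C)).mkContinuous 1 fun c => by
      rw [one_mul]; exact (norm_coe_multiplier c).le)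
  have hg (c : C) : g c = f c := rfl
  have hr : 0 < ‖g‖ := by
    obtain ⟨c, hc⟩ := hne
    rw [norm_pos_iff]
    rintro h
    exact hc (by rw [← hg, h]; rfl)
  let ω : C →ₚ[ℂ] ℂ := PositiveLinearMap.mk₀ ((‖g‖⁻¹ : ℂ) • g : StrongDual ℂ C).toLinearMap
    fun c hc => by
      have h2 : (0 : ℂ) ≤ (‖g‖⁻¹ : ℂ) := by
        rw [← Complex.ofReal_inv]; exact_mod_cast (inv_pos.2 hr).le
      exact mul_nonneg h2 (hpos c hc)
  have hω (c : C) : ω c = (‖g‖⁻¹ : ℂ) * f c := rfl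
  refine ⟨⟨ω, ?_⟩, ‖g‖, fun c => ?_⟩
  · have h2 := isLUB_norm_apply ((‖g‖⁻¹ : ℂ) • g)
    have h3 : ‖(‖g‖⁻¹ : ℂ) • g‖ = 1 := by
      rw [norm_smul, norm_inv, Complex.norm_real, norm_norm, inv_mul_cancel₀ hr.ne']
    rw [h3] at h2
    exact h2
  · simp only [hω]
    rw [mul_inv_cancel_left₀]
    exact_mod_cast hr.ne'

end GNSVectors

/-! ### From weak to norm convergence: Pc = c forces c ∈ η_L(L)C. -/

section NormConvergence

variable {L C : Type u} [NonUnitalCStarAlgebra L]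
  [NonUnitalCStarAlgebra C] [PartialOrder C] [StarOrderedRing C]

/-- Each vector functional sees `c ∈ P C**` as a limit of `η_L(e) c`. -/
theorem tendsto_gnsVec_of_openProj_mul (ηL : L →⋆ₙₐ[ℂ] 𝓜(ℂ, C)) {c : C}
    (hc : openProj ηL * (univRep C).toHom c = (univRep C).toHom c) (ω : States C)
    {E : Filter L} (hE : E.IsApproximateUnit) :
    Tendsto (fun e => gnsVec ω.1 ((ηL e).fst c)) E (𝓝 (gnsVec ω.1 c)) := by
  classical
  let ξ (d : C) : UnivSpace C := lp.single 2 ω (gnsVec ω.1 d)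
  have hξ : Continuous ξ :=
    (lp.isometry_single (E := fun ω : States C => ω.1.GNS) (p := 2) ω).continuous.comp
      (continuous_gnsVec ω.1)
  have hξmul (a d : C) : (univRep C).toHom a (ξ d) = ξ (a * d) := by
    ext ω'
    change (Rep.gns ω'.1).toHom a (ξ d ω') = ξ (a * d) ω'
    obtain rfl | h := eq_or_ne ω' ω
    · simp only [ξ, lp.single_apply_self, gns_toHom_gnsVec]
    · simp only [ξ, lp.single_apply_ne _ _ _ h, map_zero]
  -- The vector ξ(c) is the limit of ξ(ce) = c ξ(e), and P fixes each of these because Pc = c.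
  have hfix : openProj ηL (ξ c) = ξ c := by
    obtain ⟨F, hF⟩ := exists_isApproximateUnit C
    have := hF.neBot
    have h1 := (hξ.tendsto c).comp (hF.tendsto_mul_left c)
    refine tendsto_nhds_unique (((openProj ηL).continuous.tendsto _).comp h1) (h1.congr fun e => ?_)
    simp only [Function.comp_apply]
    rw [← hξmul, ← mul_apply_eq_comp, hc]
  have h1 := tendsto_essProj (compHom ηL (univRep C)) hE (ξ c)
  rw [hfix] at h1
  have h2 : Continuous fun x : UnivSpace C => x ω :=
    (lp.lipschitzWith_one_eval 2 ω).continuous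
  have h3 := (h2.tendsto _).comp h1
  have h4 (d : C) : ξ d ω = gnsVec ω.1 d := lp.single_apply_self _ _ _
  rw [h4] at h3
  refine h3.congr fun e => ?_
  have h5 := Rep.directSum_multExt_apply (fun ω : States C => Rep.gns ω.1) (ηL e) (ξ c) ω
  rw [h4, gns_multExt_gnsVec] at h5
  exact h5

/-- The positive elements c*(1-η_L(e))c decrease in e. If their norms did not tend to 0, one
functional f on M(C) would stay at least ε on all of them, at least for e in the positive open unit
ball. They belong to C, and f restricted to C is zero or a multiple of a state, whose GNS vectors
force the values of f to tend to 0. -/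
theorem mem_rightIdeal_of_openProj_mul (ηL : L →⋆ₙₐ[ℂ] 𝓜(ℂ, C)) {c : C}
    (hc : openProj ηL * (univRep C).toHom c = (univRep C).toHom c) : c ∈ rightIdeal ηL := by
  let _ := CStarAlgebra.spectralOrder L
  have _ := CStarAlgebra.spectralOrderedRing L
  let _ := CStarAlgebra.spectralOrder 𝓜(ℂ, C)
  have _ := CStarAlgebra.spectralOrderedRing 𝓜(ℂ, C)
  have hE := CStarAlgebra.increasingApproximateUnit L
  have hNe : (CStarAlgebra.approximateUnit L).NeBot := hE.neBot
  have hB := CStarAlgebra.hasBasis_approximateUnit L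
  let x (e : L) : 𝓜(ℂ, C) := star (c : 𝓜(ℂ, C)) * (1 - ηL e) * c
  have hx (e : L) : x e = ((star c * (c - (ηL e).fst c) : C) : 𝓜(ℂ, C)) := by
    change star (c : 𝓜(ℂ, C)) * (1 - ηL e) * c = _
    rw [coe_multiplier_mul, coe_multiplier_sub, coe_multiplier_star, ← multiplier_mul_coe, mul_assoc,
      sub_mul, one_mul]
  have hIcc : ∀ᶠ e in CStarAlgebra.approximateUnit L, ηL e ∈ Set.Icc 0 1 := by
    filter_upwards [hE.eventually_nonneg, hE.eventually_norm] with e h1 h2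
    have h3 : 0 ≤ ηL e := map_nonneg ηL h1
    refine ⟨h3, (CStarAlgebra.norm_le_one_iff_of_nonneg _ h3).1 ?_⟩
    exact (NonUnitalStarAlgHom.norm_apply_le ηL e).trans h2
  have hx0 : ∀ᶠ e in CStarAlgebra.approximateUnit L, 0 ≤ x e := by
    filter_upwards [hIcc] with e he
    exact star_left_conjugate_nonneg (sub_nonneg.2 he.2) _
  have hsmall (ε : ℝ) (hε : 0 < ε) : ∀ᶠ e in CStarAlgebra.approximateUnit L, ‖x e‖ < ε := by
    by_contra hcon
    simp only [not_eventually, not_lt] at hcon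
    obtain ⟨f, hf, hf1, hfx⟩ := CStarAlgebra.exists_functional_ge hε hx0 hcon
    have hlim : ∀ᶠ e in CStarAlgebra.approximateUnit L, (f (x e)).re < ε := by
      by_cases hne : ∃ c : C, f c ≠ 0
      · obtain ⟨ω, r, hω⟩ := exists_state_smul_eq hf hf1 hne
        have h1 := tendsto_gnsVec_of_openProj_mul ηL hc ω hE.toIsApproximateUnit
        have h2 : Tendsto (fun e => f (x e)) (CStarAlgebra.approximateUnit L) (𝓝 0) := by
          have h3 := (((innerSL ℂ (gnsVec ω.1 c)).continuous.tendsto _).comp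
            (h1.const_sub (gnsVec ω.1 c))).const_mul (r : ℂ)
          simp only [sub_self, map_zero, mul_zero] at h3
          refine h3.congr fun e => ?_
          rw [hx, hω, ← inner_gnsVec, map_sub]
          rfl
        have h3 := (Complex.continuous_re.tendsto _).comp h2
        exact h3.eventually_lt_const hε
      · push Not at hne
        exact .of_forall fun e => by rw [hx, hne]; exact hε
    -- The index e₀ belongs to its own basic set, where f is below ε. Eventually e ≥ e₀, so x e ≤ x
    -- e₀ and the lower bound on f applies at e₀ as well.
    obtain ⟨e₀, he₀, hsub⟩ := hB.eventually_iff.1 hlim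
    refine (hfx e₀ ?_).not_gt (hsub ⟨le_refl e₀, by simpa using he₀.2.le⟩)
    filter_upwards [hB.mem_of_mem he₀] with e he
    refine star_left_conjugate_le_conjugate ?_ _
    gcongr
    exact he.1
  rw [mem_rightIdeal_iff_tendsto hE.toIsApproximateUnit, Metric.tendsto_nhds]
  intro ε hε
  filter_upwards [hIcc, hsmall ((ε / 2) ^ 2) (by positivity)] with e he h1
  -- Since (1-e)² ≤ 1-e for 0 ≤ e ≤ 1, smallness of c*(1-e)c controls ‖c - ec‖²; hence the threshold
  -- (ε/2)².
  have h2 := CStarAlgebra.norm_sub_mul_self_le (c : 𝓜(ℂ, C)) he.1 ⟨le_rfl, he.2⟩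
    (half_pos hε).le h1.le
  rw [multiplier_mul_coe, ← coe_multiplier_sub, norm_coe_multiplier] at h2
  rw [dist_comm, dist_eq_norm]
  linarith

end NormConvergence


/-! ### Equivalent descriptions of A_L. -/

section Characterizations

variable {A : Type v} {L C : Type u} [NonUnitalCStarAlgebra A] [NonUnitalCStarAlgebra L]
  [NonUnitalCStarAlgebra C] {ηA : A →⋆ₙₐ[ℂ] 𝓜(ℂ, C)} {ηL : L →⋆ₙₐ[ℂ] 𝓜(ℂ, C)}

theorem mem_rightIdeal_iff_exists {c : C} :
    c ∈ rightIdeal ηL ↔ ∃ l, ∃ c' : C, ηL l * (c' : 𝓜(ℂ, C)) = (c : 𝓜(ℂ, C)) := by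
  simp only [multiplier_mul_coe]
  exact exists₂_congr fun l c' => coe_multiplier_injective.eq_iff.symm

theorem mul_range_subset_iff (hCP4 : IsGeneratingTriple ηA ηL) (b : A) :
    {ηA b} * Set.range ηL ⊆ Set.range ηL * Set.range (fun c : C => (c : 𝓜(ℂ, C))) ↔
      ∀ l, ∀ c : C, (c : 𝓜(ℂ, C)) = ηA b * ηL l → c ∈ rightIdeal ηL := by
  simp only [Set.singleton_mul, Set.subset_def, Set.forall_mem_image, Set.forall_mem_range,
    mem_rightIdeal_iff_exists]
  refine forall_congr' fun l => ?_
  constructor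
  · rintro ⟨_, ⟨k, rfl⟩, _, ⟨c', rfl⟩, h⟩ c hc
    exact ⟨k, c', h.trans hc.symm⟩
  · intro h
    obtain ⟨c, hc⟩ := hCP4.mul_mem b l
    obtain ⟨k, c', h'⟩ := h c hc
    exact ⟨_, ⟨k, rfl⟩, _, ⟨c', rfl⟩, h'.trans hc⟩

/-- By (CP4) the product of b and l is an element c of C, and the norm in question is ‖η_L(e)c - c‖.
-/
theorem tendsto_norm_iff (hCP4 : IsGeneratingTriple ηA ηL) {E : Filter L} (hE : E.IsApproximateUnit)
    (b : A) :
    (∀ l, Tendsto (fun e => ‖(ηL e - 1) * ηA b * ηL l‖) E (𝓝 0)) ↔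
      ∀ l, ∀ c : C, (c : 𝓜(ℂ, C)) = ηA b * ηL l → c ∈ rightIdeal ηL := by
  have key (l : L) (c : C) (hc : (c : 𝓜(ℂ, C)) = ηA b * ηL l) :
      Tendsto (fun e => ‖(ηL e - 1) * ηA b * ηL l‖) E (𝓝 0) ↔ c ∈ rightIdeal ηL := by
    rw [mem_rightIdeal_iff_tendsto hE]
    refine Iff.trans (tendsto_congr fun e => ?_) tendsto_iff_norm_sub_tendsto_zero.symm
    rw [mul_assoc, ← hc, sub_mul, one_mul, multiplier_mul_coe, ← coe_multiplier_sub,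
      norm_coe_multiplier]
  constructor
  · exact fun h l c hc => (key l c hc).1 (h l)
  · intro h l
    obtain ⟨c, hc⟩ := hCP4.mul_mem b l
    exact (key l c hc).2 (h l c hc)

/-- In b·(l m l') the left factor b l can be rewritten as k c', so the product k (c' m) l' again has
the required form. -/
theorem mem_subalgebraL_of_rightIdeal (hCP4 : IsGeneratingTriple ηA ηL) {a : A}
    (ha : ∀ b ∈ ({a, star a} : Set A), ∀ l, ∀ c : C, (c : 𝓜(ℂ, C)) = ηA b * ηL l →
      c ∈ rightIdeal ηL) : a ∈ subalgebraL ηA ηL := by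
  intro b hb T hT
  obtain ⟨l, m, l', h⟩ := mem_hereditaryL.1 hT
  obtain ⟨c, hc⟩ := hCP4.mul_mem b l
  obtain ⟨k, c', hk⟩ := mem_rightIdeal_iff_exists.1 (ha b hb l c hc)
  refine ⟨(ηA b).fst T, mem_hereditaryL.2 ⟨k, (c' : 𝓜(ℂ, C)) * m, l', ?_⟩,
    (multiplier_mul_coe _ _).symm⟩
  rw [← multiplier_mul_coe, ← h, ← mul_assoc, hk, hc]
  simp only [mul_assoc]

variable [PartialOrder C] [StarOrderedRing C]

theorem rightIdeal_of_commute {a : A} (ha : Commute ((univRep C).multExt (ηA a)) (openProj ηL)) :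
    ∀ l, ∀ c : C, (c : 𝓜(ℂ, C)) = ηA a * ηL l → c ∈ rightIdeal ηL := by
  intro l c hc
  refine mem_rightIdeal_of_openProj_mul ηL ?_
  have h := essProj_mul (compHom ηL (univRep C)) l
  change openProj ηL * (univRep C).multExt (ηL l) = (univRep C).multExt (ηL l) at h
  rw [← Rep.multExt_coe, hc, map_mul, ← mul_assoc, ← ha.eq, mul_assoc, h]

theorem commute_star {a : A} (ha : Commute ((univRep C).multExt (ηA a)) (openProj ηL)) :
    Commute ((univRep C).multExt (ηA (star a))) (openProj ηL) := by
  have h := ha.star_star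
  rwa [(isStarProjection_essProj _).isSelfAdjoint.star_eq, ← map_star, ← map_star] at h

theorem subalgebraL_tfae (hCP4 : IsGeneratingTriple ηA ηL) (a : A) :
    [a ∈ subalgebraL ηA ηL, Commute ((univRep C).multExt (ηA a)) (openProj ηL),
      ∀ b ∈ ({a, star a} : Set A), ∀ l, ∀ c : C, (c : 𝓜(ℂ, C)) = ηA b * ηL l →
        c ∈ rightIdeal ηL].TFAE := by
  tfae_have 1 → 2 := commute_essProj_of_mem_subalgebraL _
  tfae_have 2 → 3 := by
    rintro h b (rfl | rfl)
    · exact rightIdeal_of_commute h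
    · exact rightIdeal_of_commute (commute_star h)
  tfae_have 3 → 1 := mem_subalgebraL_of_rightIdeal hCP4
  tfae_finish

/-- The commutant description makes closure under the operations and topological closedness evident;
closure under the adjoint uses P = P*. -/
theorem exists_starSubalgebra_eq_subalgebraL (hCP4 : IsGeneratingTriple ηA ηL) :
    ∃ S : NonUnitalStarSubalgebra ℂ A, (S : Set A) = subalgebraL ηA ηL ∧ IsClosed (S : Set A) := by
  have h (a : A) := (subalgebraL_tfae hCP4 a).out 0 1
  let S : NonUnitalStarSubalgebra ℂ A :=
    { carrier := {a | Commute ((univRep C).multExt (ηA a)) (openProj ηL)}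
      add_mem' := fun {a b} ha hb => by
        simp only [Set.mem_ofPred_eq, map_add] at ha hb ⊢
        exact ha.add_left hb
      zero_mem' := by simp only [Set.mem_ofPred_eq, map_zero]; exact Commute.zero_left _
      mul_mem' := fun {a b} ha hb => by
        simp only [Set.mem_ofPred_eq, map_mul] at ha hb ⊢
        exact ha.mul_left hb
      smul_mem' := fun c a ha => by
        simp only [Set.mem_ofPred_eq, map_smul] at ha ⊢
        exact ha.smul_left c
      star_mem' := fun ha => commute_star ha }
  refine ⟨S, (Set.ext h).symm, ?_⟩
  have hc : Continuous fun a => (univRep C).multExt (ηA a) :=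
    (AddMonoidHomClass.continuous_of_bound (univRep C).multExt 1
      (by simpa only [one_mul] using! NonUnitalStarAlgHom.norm_apply_le _)).comp <|
      AddMonoidHomClass.continuous_of_bound ηA 1
        (by simpa only [one_mul] using! NonUnitalStarAlgHom.norm_apply_le ηA)
  exact isClosed_eq (hc.mul continuous_const) (continuous_const.mul hc)

end Characterizations

theorem commute_iff_eq_add {R : Type*} [Ring R] {p : R} (hp : IsIdempotentElem p) (x : R) :
    Commute x p ↔ x = p * x * p + (1 - p) * x * (1 - p) := by
  have hp' := hp.eq
  constructor
  · intro h
    have h' : p * x = x * p := h.eq.symm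
    simp only [mul_sub, sub_mul, mul_one, one_mul, h', mul_assoc, hp']
    abel
  · intro h
    have h1 : x * p = p * x * p := by
      conv_lhs => rw [h]
      simp [add_mul, mul_assoc, hp', sub_mul, mul_sub]
    have h2 : p * x = p * x * p := by
      conv_lhs => rw [h]
      simp only [mul_add, sub_mul, mul_sub, ← mul_assoc, hp', mul_one, one_mul]
      abel
    exact h1.trans h2.symm

/-! ### Commutants of representations of a host algebra. -/

section HostAlgebra

variable {G : Type w} [Group G] [TopologicalSpace G] {L : Type u} [NonUnitalCStarAlgebra L]
variable {H : Type u} [NormedAddCommGroup H] [InnerProductSpace ℂ H] [CompleteSpace H]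

/-- A representation of a host algebra generates no more than its unitaries do: the commutant of
the unitary representation commutes with the algebra. -/
theorem IsHostAlgebra.commute_of_unitary {η : G →* unitary 𝓜(ℂ, L)} (hη : IsHostAlgebra η)
    (π : Rep L H) {V : H →L[ℂ] H} (hV : V ∈ unitary (H →L[ℂ] H))
    (hVG : ∀ g, Commute V (π.multExt (η g))) (l : L) : Commute V (π.toHom l) := by
  have hV1 : star V * V = 1 := (Unitary.mem_iff.1 hV).1
  have hV2 : V * star V = 1 := (Unitary.mem_iff.1 hV).2
  let π' : Rep L H :=
    { toHom :=
        { toFun l := V * π.toHom l * star V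
          map_smul' c l := by simp
          map_zero' := by simp
          map_add' a b := by simp [mul_add, add_mul]
          map_mul' a b := by
            rw [map_mul]
            calc V * (π.toHom a * π.toHom b) * star V
                = V * π.toHom a * 1 * π.toHom b * star V := by simp only [mul_one, mul_assoc]
              _ = _ := by rw [← hV1]; simp only [mul_assoc]
          map_star' a := by simp only [map_star, star_mul, star_star, mul_assoc] }
      nondegenerate := by
        rw [isNondegenerate_iff]
        intro v hv
        have h1 (a : L) : π.toHom a (star V v) = 0 := by
          have h2 : π.toHom a * star V = star V * (V * π.toHom a * star V) := by
            simp only [← mul_assoc, hV1, one_mul]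
          have h3 := congrArg (· v) h2
          simp only [mul_apply_eq_comp] at h3
          rw [h3]
          have h4 := hv a
          change V (π.toHom a (star V v)) = 0 at h4
          rw [h4, map_zero]
        have h2 := (isNondegenerate_iff _).1 π.nondegenerate _ h1
        have h3 : (V * star V) v = 0 := by rw [mul_apply_eq_comp, h2, map_zero]
        rwa [hV2] at h3 }
  have h1 (m : 𝓜(ℂ, L)) : π'.multExt m = V * π.multExt m * star V := by
    refine π'.clm_ext fun a v => ?_
    rw [π'.multExt_apply_apply]
    change V (π.toHom (m.fst a) (star V v)) = V (π.multExt m ((star V * V) (π.toHom a (star V v))))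
    rw [hV1, one_apply_eq_self, π.multExt_apply_apply]
  -- Conjugation by V leaves every unitary of G unchanged, so injectivity on representations
  -- identifies the conjugate V π V* with π.
  have h2 : π' = π := hη.injective_rep H <| funext fun g => by
    change π'.multExt (η g) = π.multExt (η g)
    rw [h1, (hVG g).eq, mul_assoc, hV2, mul_one]
  have h3 : V * π.toHom l * star V = π.toHom l := by
    conv_rhs => rw [← h2]
    rfl
  calc V * π.toHom l = V * π.toHom l * (star V * V) := by rw [hV1, mul_one]
    _ = π.toHom l * V := by rw [← mul_assoc, h3]

omit [TopologicalSpace G] in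
theorem star_multExt_unitary {K : Type*} [NormedAddCommGroup K] [InnerProductSpace ℂ K]
    [CompleteSpace K] {η : G →* unitary 𝓜(ℂ, L)} (π : Rep L K) (g : G) :
    star (π.multExt (η g)) = π.multExt (η g⁻¹) := by
  rw [← map_star, map_inv, ← Unitary.star_eq_inv, Unitary.coe_star]

/-- The commutant of the unitaries of G is a unital C*-algebra, since the adjoint of the unitary of
g is that of g⁻¹. It is therefore spanned by its own unitaries, which reduces the claim to the
unitary case. -/
theorem IsHostAlgebra.commute_of_commute {η : G →* unitary 𝓜(ℂ, L)} (hη : IsHostAlgebra η)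
    (π : Rep L H) {T : H →L[ℂ] H} (hT : ∀ g, Commute T (π.multExt (η g))) (l : L) :
    Commute T (π.toHom l) := by
  let S : StarSubalgebra ℂ (H →L[ℂ] H) :=
    StarSubalgebra.centralizer ℂ (Set.range fun g => π.multExt (η g))
  have hS (V : H →L[ℂ] H) : V ∈ S ↔ ∀ g, Commute V (π.multExt (η g)) := by
    rw [StarSubalgebra.mem_centralizer_iff]
    constructor
    · exact fun h g => (h _ ⟨g, rfl⟩).1.symm
    · rintro h _ ⟨g, rfl⟩
      refine ⟨(h g).symm.eq, ?_⟩
      have h2 := h g⁻¹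
      rw [← star_multExt_unitary] at h2
      exact h2.symm.eq
  have : IsClosed (S : Set (H →L[ℂ] H)) := by
    have : (S : Set (H →L[ℂ] H)) = ⋂ g, {V | V * π.multExt (η g) = π.multExt (η g) * V} := by
      ext V
      simp only [SetLike.mem_coe, hS, Set.mem_iInter]
      rfl
    rw [this]
    exact isClosed_iInter fun g => isClosed_eq (by fun_prop) (by fun_prop)
  let _ : CStarAlgebra S := inferInstance
  have h1 : (⟨T, (hS T).2 hT⟩ : S) ∈ Submodule.span ℂ (unitary S : Set S) := by
    rw [CStarAlgebra.span_unitary]; trivial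
  suffices ∀ V ∈ Submodule.span ℂ (unitary S : Set S), Commute (V : H →L[ℂ] H) (π.toHom l) from
    this _ h1
  intro V hV
  induction hV using Submodule.span_induction with
  | mem V hV =>
    refine hη.commute_of_unitary π ?_ ((hS V).1 V.2) l
    rw [SetLike.mem_coe, Unitary.mem_iff] at hV
    exact Unitary.mem_iff.2 ⟨congrArg Subtype.val hV.1, congrArg Subtype.val hV.2⟩
  | zero => exact Commute.zero_left _
  | add x y _ _ hx hy => exact hx.add_left hy
  | smul c x _ hx => exact hx.smul_left c

end HostAlgebra

/-! ### Covariance: α-invariance and fixed points. -/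

section Covariance

variable {G : Type w} [Group G]
  {A : Type v} {L C : Type u} [NonUnitalCStarAlgebra A] [NonUnitalCStarAlgebra L]
  [NonUnitalCStarAlgebra C]
  {η : G →* unitary 𝓜(ℂ, L)} {α : G →* (A ≃⋆ₐ[ℂ] A)}
  {ηA : A →⋆ₙₐ[ℂ] 𝓜(ℂ, C)} {ηL : L →⋆ₙₐ[ℂ] 𝓜(ℂ, C)}

/-- Under ρ, α_g(a)l becomes U(g) a U(g)* l = U(g) a (η(g⁻¹)l). The hypothesis on a rewrites a
(η(g⁻¹)l) as k c', and U(g) is absorbed into k as η(g)k. Faithfulness returns the identity to M(C).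
-/
theorem rightIdeal_of_covariant {H : Type*} [NormedAddCommGroup H] [InnerProductSpace ℂ H]
    [CompleteSpace H] (ρ : Rep C H) (hρ : IsLRep ηL ρ) (hinj : Function.Injective ρ.toHom)
    (hcov : ∀ g a, unitaryRep η ηL ρ hρ g * ρ.multExt (ηA a) * star (unitaryRep η ηL ρ hρ g) =
      ρ.multExt (ηA (α g a)))
    (hCP4 : IsGeneratingTriple ηA ηL) (g : G) {a : A}
    (ha : ∀ l, ∀ c : C, (c : 𝓜(ℂ, C)) = ηA a * ηL l → c ∈ rightIdeal ηL) :
    ∀ l, ∀ c : C, (c : 𝓜(ℂ, C)) = ηA (α g a) * ηL l → c ∈ rightIdeal ηL := by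
  intro l c hc
  have hU (g : G) (l : L) : unitaryRep η ηL ρ hρ g * ρ.multExt (ηL l) =
      ρ.multExt (ηL ((η g : 𝓜(ℂ, L)).fst l)) := unitaryRep_mul_compHom η ηL ρ hρ g l
  have hstar : star (unitaryRep η ηL ρ hρ g) = unitaryRep η ηL ρ hρ g⁻¹ :=
    star_multExt_unitary (Rep.mk (compHom ηL ρ) hρ) g
  obtain ⟨d, hd⟩ := hCP4.mul_mem a ((η g⁻¹ : 𝓜(ℂ, L)).fst l)
  obtain ⟨k, c', hk⟩ := mem_rightIdeal_iff_exists.1 (ha _ _ hd)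
  refine mem_rightIdeal_iff_exists.2 ⟨(η g : 𝓜(ℂ, L)).fst k, c', ?_⟩
  refine ρ.multExt_injective hinj ?_
  rw [hc, map_mul, map_mul, ← hU, ← hcov, hstar, mul_assoc, mul_assoc, hU,
    mul_assoc, ← map_mul, ← map_mul, hk, hd]

/-- A fixed element commutes with every U(g), so by the host property it commutes with η_L(L) in
M(C). Then (η_L(e) - 1) a η_L(l) = η_L(el - l) a, which tends to 0. -/
theorem rightIdeal_of_fixed [TopologicalSpace G] (hη : IsHostAlgebra η)
    {H : Type u} [NormedAddCommGroup H] [InnerProductSpace ℂ H]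
    [CompleteSpace H] (ρ : Rep C H) (hρ : IsLRep ηL ρ) (hinj : Function.Injective ρ.toHom)
    {a : A} (ha : ∀ g, unitaryRep η ηL ρ hρ g * ρ.multExt (ηA a) *
      star (unitaryRep η ηL ρ hρ g) = ρ.multExt (ηA a))
    (hCP4 : IsGeneratingTriple ηA ηL) :
    ∀ l, ∀ c : C, (c : 𝓜(ℂ, C)) = ηA a * ηL l → c ∈ rightIdeal ηL := by
  have h1 (g : G) : Commute (ρ.multExt (ηA a)) ((Rep.mk (compHom ηL ρ) hρ).multExt (η g)) := by
    have hu : star (unitaryRep η ηL ρ hρ g) * unitaryRep η ηL ρ hρ g = 1 := by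
      rw [unitaryRep, ← map_star, ← map_mul, Unitary.coe_star_mul_self, map_one]
    have h2 := congrArg (· * unitaryRep η ηL ρ hρ g) (ha g)
    simp only [mul_assoc, hu, mul_one] at h2
    exact h2.symm
  have h2 (l : L) : ηA a * ηL l = ηL l * ηA a := by
    refine ρ.multExt_injective hinj ?_
    rw [map_mul, map_mul]
    exact hη.commute_of_commute (Rep.mk (compHom ηL ρ) hρ) h1 l
  obtain ⟨E, hE⟩ := exists_isApproximateUnit L
  refine (tendsto_norm_iff hCP4 hE a).1 fun l => ?_
  have h3 : Tendsto (fun e => ηL (e * l - l) * ηA a) E (𝓝 0) := by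
    have hc : Continuous fun k => ηL (k - l) * ηA a := by
      have : Continuous ηL := AddMonoidHomClass.continuous_of_bound ηL 1
        (by simpa only [one_mul] using! NonUnitalStarAlgHom.norm_apply_le ηL)
      fun_prop
    have h4 := (hc.tendsto l).comp (hE.tendsto_mul_right l)
    simpa only [sub_self, map_zero, zero_mul] using! h4
  rw [tendsto_zero_iff_norm_tendsto_zero] at h3
  refine h3.congr fun e => ?_
  rw [mul_assoc, h2, ← mul_assoc, sub_mul, one_mul, ← map_mul, map_sub]

variable [PartialOrder C] [StarOrderedRing C]

theorem map_mem_subalgebraL (hα : CovarianceCondition η α ηA ηL)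
    (hCP4 : IsGeneratingTriple ηA ηL) (g : G) {a : A} (ha : a ∈ subalgebraL ηA ηL) :
    α g a ∈ subalgebraL ηA ηL := by
  have h := ((subalgebraL_tfae hCP4 a).out 0 2).1 ha
  refine mem_subalgebraL_of_rightIdeal hCP4 ?_
  rintro b (rfl | rfl)
  · exact rightIdeal_of_covariant _ (univLRep_isLRep ηL) hα.1 hα.2 hCP4 g (h a (by simp))
  · rw [← map_star]
    exact rightIdeal_of_covariant _ (univLRep_isLRep ηL) hα.1 hα.2 hCP4 g (h (star a) (by simp))

end Covariance

end CrossedHost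

theorem mainTheorem12 {G : Type w} [Group G] [TopologicalSpace G] [IsTopologicalGroup G]
    {A : Type v} {L C : Type u} [NonUnitalCStarAlgebra A] [NonUnitalCStarAlgebra L]
    [NonUnitalCStarAlgebra C] [PartialOrder C] [StarOrderedRing C]
    (η : G →* unitary 𝓜(ℂ, L)) (hη : CrossedHost.IsHostAlgebra η)
    (α : G →* (A ≃⋆ₐ[ℂ] A))
    (ηA : A →⋆ₙₐ[ℂ] 𝓜(ℂ, C)) (ηL : L →⋆ₙₐ[ℂ] 𝓜(ℂ, C))
    (hCP4 : CrossedHost.IsGeneratingTriple ηA ηL) :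
    -- the projection `P = lim η_L(E_j)` in `C**` exists
    (∃! P, CrossedHost.IsOpenProjection ηL P) ∧
    -- characterization by commutation with `P`, and by block-diagonality
    (∀ P, CrossedHost.IsOpenProjection ηL P →
      IsStarProjection P ∧
      CrossedHost.subalgebraL ηA ηL =
        {a | Commute ((CrossedHost.univRep C).multExt (ηA a)) P} ∧
      CrossedHost.subalgebraL ηA ηL =
        {a | (CrossedHost.univRep C).multExt (ηA a) =
          P * (CrossedHost.univRep C).multExt (ηA a) * P +
            (1 - P) * (CrossedHost.univRep C).multExt (ηA a) * (1 - P)}) ∧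
    -- characterization by `η_A(a) η_L(L) ⊆ η_L(L) C`, for `a` and its adjoint
    CrossedHost.subalgebraL ηA ηL =
      {a | ∀ b ∈ ({a, star a} : Set A),
        {ηA b} * Set.range ηL ⊆ Set.range ηL * Set.range fun c : C => (c : 𝓜(ℂ, C))} ∧
    -- characterization by approximate identities
    (∀ E : Filter L, E.IsApproximateUnit →
      CrossedHost.subalgebraL ηA ηL =
        {a | ∀ b ∈ ({a, star a} : Set A), ∀ l : L,
          Tendsto (fun e => ‖(ηL e - 1) * ηA b * ηL l‖) E (𝓝 0)}) ∧
    -- invariance under `α` and fixed points, under the covariance condition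
    (CrossedHost.CovarianceCondition η α ηA ηL →
      (∃ S : NonUnitalStarSubalgebra ℂ A,
        (S : Set A) = CrossedHost.subalgebraL ηA ηL ∧ IsClosed (S : Set A)) ∧
      (∀ g, α g '' CrossedHost.subalgebraL ηA ηL = CrossedHost.subalgebraL ηA ηL) ∧
      {a | ∀ g, α g a = a} ⊆ CrossedHost.subalgebraL ηA ηL) := by

  have hP {P} (h : CrossedHost.IsOpenProjection ηL P) := h.eq_openProj
  have htfae := CrossedHost.subalgebraL_tfae (ηA := ηA) (ηL := ηL) hCP4
  refine ⟨⟨_, CrossedHost.isOpenProjection_openProj ηL, fun _ h => hP h⟩, ?_, ?_, ?_, ?_⟩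
  · rintro P h
    obtain rfl := hP h
    have hproj := CrossedHost.isStarProjection_essProj
      (CrossedHost.compHom ηL (CrossedHost.univRep C))
    refine ⟨hproj, Set.ext fun a => (htfae a).out 0 1, Set.ext fun a => ?_⟩
    exact ((htfae a).out 0 1).trans (CrossedHost.commute_iff_eq_add hproj.isIdempotentElem _)
  · refine Set.ext fun a => ((htfae a).out 0 2).trans ?_
    exact forall₂_congr fun b _ => (CrossedHost.mul_range_subset_iff hCP4 b).symm
  · refine fun E hE => Set.ext fun a => ((htfae a).out 0 2).trans ?_
    exact forall₂_congr fun b _ => (CrossedHost.tendsto_norm_iff hCP4 hE b).symm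
  · intro hα
    refine ⟨CrossedHost.exists_starSubalgebra_eq_subalgebraL hCP4, fun g => ?_, fun a ha => ?_⟩
    · refine Set.Subset.antisymm ?_ fun a ha => ⟨α g⁻¹ a, ?_, ?_⟩
      · rintro _ ⟨a, ha, rfl⟩
        exact CrossedHost.map_mem_subalgebraL hα hCP4 g ha
      · exact CrossedHost.map_mem_subalgebraL hα hCP4 g⁻¹ ha
      · rw [← StarAlgEquiv.mul_apply, ← map_mul, mul_inv_cancel, map_one, StarAlgEquiv.one_apply]
    · refine CrossedHost.mem_subalgebraL_of_rightIdeal hCP4 ?_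
      -- Stated for general b because it is needed for a and for its adjoint, which is fixed as
      -- well.
      have key (b : A) (hb : ∀ g, α g b = b) := CrossedHost.rightIdeal_of_fixed hη
        (CrossedHost.univLRep ηL) (CrossedHost.univLRep_isLRep ηL) hα.1 (a := b)
        (fun g => (hα.2 g b).trans <|
          congrArg (fun x => (CrossedHost.univLRep ηL).multExt (ηA x)) (hb g)) hCP4
      rintro b (rfl | rfl)
      · exact key b ha
      · exact key _ fun g => by rw [map_star, ha g]
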